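/- All graphs are finite, simple and undirected. For $k\ge 1$, a \emph{$k$-star} is a tree obtained from a star by replacing each edge by a path of length at least $1$ and at most $k$. An instance of the firefighter problem consists of a graph $G=(V,E)$ with $|V|=n$, a vertex $s\in V$ on fire at time $0$, a set $S\subseteq V$, budgets $b_1,\dots,b_n\in\mathbb N$, and a set $F\subseteq V\times\{1,\dots,n\}$ of forbidden protections. A strategy is a set $\Phi\subseteq V\times\{1,\dots,n\}$; $(v,t)\in\Phi$ means that $v$ is protected at time step $t$, and then $v$ remains protected. At times $0$ and $1$ only $s$ is burned; for $t\ge 1$ the vertices burned at time $t+1$ are those burned at time $t$ together with all vertices that are adjacent to a vertex burned at time $t$ and have not been protected at time step $t$ or earlier. The strategy $\Phi$ is valid if $\Phi\cap F=\emptyset$, no $v$ with $(v,t)\in\Phi$ is burned at time $t$, and at most $b_t$ vertices are protected at time step $t$, for each $t\in\{1,\dots,n\}$. A vertex is saved if, at time $n$, it is protected or every path from a burned vertex to it contains a protected vertex. The task is to output a valid strategy that maximizes the number of saved vertices of $S$. Max $b$-Save is the special case $b_1=\dots=b_n=b$, $F=\emptyset$. Theorem. (1) For all $k\ge 1$ and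 $b\ge 1$, Max $b$-Save is solvable in polynomial time on $k$-stars (with an arbitrary burning vertex $s$). (2) More generally, there are a single algorithm and a single polynomial $f$ such that, for every $k\ge1$, every $k$-star $G$ with $n$ vertices, and all $s$, $S$, $b_1,\dots,b_n$ and $F$ as above, the algorithm outputs an optimal valid strategy in at most $f(n)$ steps. In particular the running time is polynomial uniformly in $k$, and time-varying budgets and forbidden protections are allowed. Here algorithms are programs of a random access machine with unit-cost addition, truncated subtraction, comparison with $0$ and indirect addressing (no multiplication), which receive $n$, $s$, the adjacency matrix of $G$, the indicator of $S$, the budgets and the indicator of $F$ as input; $f$ in (2), and the polynomial in (1), is a polynomial in $n$. -/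

import Mathlib

namespace Firefighter

/-! ### `k`-stars -/

/-- The tree obtained from a star with `d` edges by replacing its `j`-th edge by a path of length
`len j`.  The vertex `none` is the center, and `some ⟨j, i⟩` is the vertex of the `j`-th path
at distance `i + 1` from the center. -/
def subdividedStar {d : ℕ} (len : Fin d → ℕ) :
    SimpleGraph (Option (Σ j : Fin d, Fin (len j))) :=
  SimpleGraph.fromRel fun x y =>
    match x, y with
    | none, some q => (q.2 : ℕ) = 0
    | some p, some q => p.1 = q.1 ∧ (p.2 : ℕ) + 1 = (q.2 : ℕ)
    | _, none => False

/-- `G` is a `k`-star: a star in which every edge is replaced by a path of length at least one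
and at most `k`. -/
def IsKStar {V : Type*} (k : ℕ) (G : SimpleGraph V) : Prop :=
  ∃ (d : ℕ) (len : Fin d → ℕ), (∀ j, 1 ≤ len j ∧ len j ≤ k) ∧
    Nonempty (G ≃g subdividedStar len)

/-! ### The firefighter problem -/

/-- An instance: a graph on the `n` vertices `0, …, n - 1`, the vertex `source` on fire at time `0`,
the set `targets` of vertices that one wants to save, the number `budget t` of vertices that may be
protected at time step `t`, and the set `forbidden` of pairs `(v, t)` such that `v` may not be
protected at time step `t`. -/
structure Instance where
  n : ℕ
  graph : SimpleGraph (Fin n)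
  source : Fin n
  targets : Finset (Fin n)
  budget : ℕ → ℕ
  forbidden : Finset (Fin n × ℕ)

namespace Instance

variable (I : Instance)

/-- A protection strategy; `(v, t) ∈ Φ` means that `v` is protected at time step `t`.  That the
times lie in `{1, …, n}` is part of `IsValid`. -/
abbrev Strategy : Type := Finset (Fin I.n × ℕ)

/-- `v` has been protected at time step `t` or earlier. -/
def ProtectedBy (Φ : I.Strategy) (t : ℕ) (v : Fin I.n) : Prop :=
  ∃ t', t' ≤ t ∧ (v, t') ∈ Φ

/-- The set of vertices that are burned at time `t`.  The fire spreads from time `t` to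
time `t + 1` for `t ≥ 1`, after the protections of time step `t`. -/
def burned (Φ : I.Strategy) : ℕ → Set (Fin I.n)
  | 0 => {I.source}
  | t + 1 => burned Φ t ∪
      {v | 1 ≤ t ∧ ¬ I.ProtectedBy Φ t v ∧ ∃ u ∈ burned Φ t, I.graph.Adj u v}

/-- `v` is saved at time `t`: it is protected, or every path from a burned vertex to `v` contains
a protected vertex. -/
def SavedAt (Φ : I.Strategy) (t : ℕ) (v : Fin I.n) : Prop :=
  I.ProtectedBy Φ t v ∨
    ∀ u ∈ I.burned Φ t, ∀ w : I.graph.Walk u v, w.IsPath →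
      ∃ x ∈ w.support, I.ProtectedBy Φ t x

/-- Valid strategies: times are in `{1, …, n}`, no vertex is protected when it is already burned,
no forbidden protection is used, and the budget of every time step is respected. -/
def IsValid (Φ : I.Strategy) : Prop :=
  (∀ v t, (v, t) ∈ Φ →
    1 ≤ t ∧ t ≤ I.n ∧ v ∉ I.burned Φ t ∧ (v, t) ∉ I.forbidden) ∧
  ∀ t, 1 ≤ t → t ≤ I.n → (Φ.filter fun p => p.2 = t).card ≤ I.budget t

/-- The number of target vertices that are saved at the end (the last time step is `n`). -/
noncomputable def savedCount (Φ : I.Strategy) : ℕ :=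
  {v : Fin I.n | v ∈ I.targets ∧ I.SavedAt Φ I.n v}.ncard

/-- `Φ` is a valid strategy that maximizes the number of saved target vertices. -/
def IsOptimal (Φ : I.Strategy) : Prop :=
  I.IsValid Φ ∧ ∀ Ψ : I.Strategy, I.IsValid Ψ → I.savedCount Ψ ≤ I.savedCount Φ

end Instance

/-- The instances of Max `b`-Save: constant budget `b`, every protection allowed. -/
def MaxSave (b : ℕ) : Set Instance :=
  {I | (∀ t, I.budget t = b) ∧ I.forbidden = ∅}

/-! ### Random access machines

Programs over natural-number registers and two-dimensional arrays; a program mentions only finitely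
many of them.  The arithmetic is addition and truncated subtraction, with unit cost; as there is no
multiplication, bit lengths grow by at most one per step, so that polynomial time on this machine is
polynomial time on a Turing machine. -/

/-- A memory state: `reg x` is the content of register `x`, and `arr a i j` is the entry `(i, j)`
of array `a`. -/
structure State where
  reg : ℕ → ℕ
  arr : ℕ → ℕ → ℕ → ℕ

/-- Expressions. -/
inductive Expr where
  | const (c : ℕ)
  | reg (x : ℕ)
  | get (a : ℕ) (i j : Expr)
  | add (e f : Expr)
  | sub (e f : Expr)

namespace Expr

/-- The value of an expression. -/
def eval (σ : State) : Expr → ℕ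
  | const c => c
  | reg x => σ.reg x
  | get a i j => σ.arr a (i.eval σ) (j.eval σ)
  | add e f => e.eval σ + f.eval σ
  | sub e f => e.eval σ - f.eval σ

/-- The number of steps needed to evaluate an expression: one for each of its nodes. -/
def cost : Expr → ℕ
  | const _ => 1
  | reg _ => 1
  | get _ i j => i.cost + j.cost + 1
  | add e f => e.cost + f.cost + 1
  | sub e f => e.cost + f.cost + 1

end Expr

/-- Programs.  Conditions are expressions, and a value other than `0` means true. -/
inductive Program where
  | skip
  | assign (x : ℕ) (e : Expr)
  | store (a : ℕ) (i j e : Expr)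
  | seq (p q : Program)
  | ite (e : Expr) (p q : Program)
  | loop (e : Expr) (p : Program)

/-- The state after the assignment of `c` to register `x`. -/
def State.setReg (σ : State) (x c : ℕ) : State where
  reg := Function.update σ.reg x c
  arr := σ.arr

/-- The state after the assignment of `c` to the entry `(i, j)` of array `a`. -/
def State.setArr (σ : State) (a i j c : ℕ) : State where
  reg := σ.reg
  arr := fun a' i' j' => if a' = a ∧ i' = i ∧ j' = j then c else σ.arr a' i' j'

/-- `Runs p σ σ' t`: the program `p`, started in state `σ`, halts in state `σ'` after
exactly `t` steps. -/
inductive Runs : Program → State → State → ℕ → Prop where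
  | skip (σ : State) : Runs .skip σ σ 1
  | assign (σ : State) (x : ℕ) (e : Expr) :
      Runs (.assign x e) σ (σ.setReg x (e.eval σ)) (e.cost + 1)
  | store (σ : State) (a : ℕ) (i j e : Expr) :
      Runs (.store a i j e) σ (σ.setArr a (i.eval σ) (j.eval σ) (e.eval σ))
        (i.cost + j.cost + e.cost + 1)
  | seq {p q : Program} {σ σ₁ σ₂ : State} {t₁ t₂ : ℕ} :
      Runs p σ σ₁ t₁ → Runs q σ₁ σ₂ t₂ → Runs (.seq p q) σ σ₂ (t₁ + t₂)
  | ite_true {e : Expr} {p q : Program} {σ σ' : State} {t : ℕ} :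
      e.eval σ ≠ 0 → Runs p σ σ' t → Runs (.ite e p q) σ σ' (e.cost + 1 + t)
  | ite_false {e : Expr} {p q : Program} {σ σ' : State} {t : ℕ} :
      e.eval σ = 0 → Runs q σ σ' t → Runs (.ite e p q) σ σ' (e.cost + 1 + t)
  | loop_exit {e : Expr} {p : Program} {σ : State} :
      e.eval σ = 0 → Runs (.loop e p) σ σ (e.cost + 1)
  | loop_step {e : Expr} {p : Program} {σ σ₁ σ₂ : State} {t₁ t₂ : ℕ} :
      e.eval σ ≠ 0 → Runs p σ σ₁ t₁ → Runs (.loop e p) σ₁ σ₂ t₂ →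
      Runs (.loop e p) σ σ₂ (e.cost + 1 + t₁ + t₂)

open Classical in
/-- The initial state for an instance.  Register `0` holds `n` and register `1` the source; array
`0` is the adjacency matrix, row `0` of array `1` the indicator of the targets, row `0` of array `2`
the sequence of budgets, and array `3` the matrix of the forbidden pairs (vertex, time).  All other
memory cells hold `0`. -/
noncomputable def Instance.encode (I : Instance) : State where
  reg := fun x => if x = 0 then I.n else if x = 1 then (I.source : ℕ) else 0
  arr := fun a i j =>
    if a = 0 then
      if ∃ (hi : i < I.n) (hj : j < I.n), I.graph.Adj ⟨i, hi⟩ ⟨j, hj⟩ then 1 else 0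
    else if a = 1 then
      if i = 0 ∧ ∃ hj : j < I.n, (⟨j, hj⟩ : Fin I.n) ∈ I.targets then 1 else 0
    else if a = 2 then
      if i = 0 ∧ 1 ≤ j ∧ j ≤ I.n then I.budget j else 0
    else if a = 3 then
      if 1 ≤ j ∧ j ≤ I.n ∧ ∃ hi : i < I.n, ((⟨i, hi⟩ : Fin I.n), j) ∈ I.forbidden then 1 else 0
    else 0

/-- The strategy that a final state describes: `v` is protected at time step `t` if the
entry `(v, t)` of array `4` is not `0`. -/
def Instance.decode (I : Instance) (σ : State) : I.Strategy :=
  (Finset.univ ×ˢ Finset.Icc 1 I.n).filter fun p => σ.arr 4 (p.1 : ℕ) p.2 ≠ 0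

/-- There are one program and one polynomial such that, on every instance of the class `C`, the
program halts with an optimal strategy after a number of steps that is at most the polynomial in the
number of vertices. -/
def PolyTimeSolvable (C : Set Instance) : Prop :=
  ∃ (p : Program) (f : Polynomial ℕ), ∀ I ∈ C, ∃ (σ : State) (t : ℕ),
    Runs p I.encode σ t ∧ t ≤ f.eval I.n ∧ I.IsOptimal (I.decode σ)

end Firefighter

/-!
The algorithm rests on the structure of a `k`-star rooted at the burning vertex `s`.  It is a tree in
which only the center `c` can have more than two neighbors.  Given a valid strategy, only its
exposed protections matter, that is, those of vertices without a protected proper ancestor; such a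
vertex `v` has to be protected by time `dist s v`, and what is saved is the union of the disjoint
subtrees of these vertices.  If an exposed vertex lies on the path from `s` to `c`, there is at most
one exposed vertex in each component of `G - s`; otherwise there is at most one in each component
that remains when the path from `s` to `c` is removed.  So for `q = s` or `q = c` the exposed
protections form a *selection* for `q`: at most one protection `(v, t)`, with `t ≤ dist s v`, in each
component that remains when the path from `s` to `q` is removed (`exists_isSelection`).  Conversely,
each selection is a valid strategy that saves the disjoint subtrees of its vertices
(`IsSelection.isValid`, `IsSelection.sum_gain_le`).  Hence it suffices to find a best selection for
every vertex `q` and to take the best of these; the center need not be found.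

A best selection for `q` is a maximum weight bipartite matching between components and slots, where
time step `t` provides `budget t` slots, at most `n` of which are relevant.  It is found by an
auction: as long as some component without a slot can make a positive profit at the current prices,
it takes a slot of maximal profit, expels the previous user, and raises the price by one.  Prices
and profits form a dual solution which shows that the result is optimal up to an error of one for
each component (`Market.Inv.sum_wt_le`), and scaling the weights by `n + 1` makes it
optimal (`Market.Inv.sum_le`).  The sum of the prices increases with each bid and stays
below `n ^ 4`, so that `n ^ 4` passes over all possible bids suffice.

For the running time, the algorithm is written in a small language whose loops run over
`{0, …, n - 1}` and whose variables are immutable.  Programs of this language compile to the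
random access machine with a polynomial time bound, by induction on the
program (`Cmd.runs_compile`), so that only the correctness of `mainCmd` has to be shown.
-/

namespace Firefighter

/-! ### A language of bounded loops -/

/-- The arrays of a memory state. -/
abbrev Arrays : Type := ℕ → ℕ → ℕ → ℕ

/-- Terms: expressions with conditionals and sums over `{0, …, n - 1}`, where `n` is the value of
the variable `0`.  Variables are named by numbers; `sum x e` binds the variable `x` in `e`. -/
inductive Term where
  | const (c : ℕ)
  | var (x : ℕ)
  | get (a : ℕ) (i j : Term)
  | add (e f : Term)
  | sub (e f : Term)
  | ite (c e f : Term)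
  | sum (x : ℕ) (e : Term)

namespace Term

/-- The value of a term in the environment `ρ`. -/
def eval (A : Arrays) : Term → (ℕ → ℕ) → ℕ
  | const c, _ => c
  | var x, ρ => ρ x
  | get a i j, ρ => A a (i.eval A ρ) (j.eval A ρ)
  | add e f, ρ => e.eval A ρ + f.eval A ρ
  | sub e f, ρ => e.eval A ρ - f.eval A ρ
  | ite c e f, ρ => if c.eval A ρ ≠ 0 then e.eval A ρ else f.eval A ρ
  | sum x e, ρ => ∑ i ∈ Finset.range (ρ 0), e.eval A (Function.update ρ x i)

/-- The free variables are in the list `l`, no binder rebinds a variable that is in scope, and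
array `5`, which is reserved for the intermediate results of the compiled program, is not read. -/
def wf : Term → List ℕ → Bool
  | const _, _ => true
  | var x, l => l.contains x
  | get a i j, l => a != 5 && i.wf l && j.wf l
  | add e f, l => e.wf l && f.wf l
  | sub e f, l => e.wf l && f.wf l
  | ite c e f, l => c.wf l && e.wf l && f.wf l
  | sum x e, l => !l.contains x && e.wf (x :: l)

theorem eval_congr {A B : Arrays} (hA : ∀ a, a ≠ 5 → A a = B a) :
    ∀ (e : Term) (l : List ℕ) (ρ τ : ℕ → ℕ), 0 ∈ l → e.wf l → (∀ x ∈ l, ρ x = τ x) →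
      e.eval A ρ = e.eval B τ := by
  intro e
  induction e with
  | const c => intros; rfl
  | var x =>
    intro l ρ τ _ hs h
    exact h x (by simpa [wf] using hs)
  | get a i j hi hj =>
    intro l ρ τ hl hs h
    simp only [wf, Bool.and_eq_true, bne_iff_ne] at hs
    simp only [eval, hi l ρ τ hl hs.1.2 h, hj l ρ τ hl hs.2 h, hA a hs.1.1]
  | add e f he hf =>
    intro l ρ τ hl hs h
    simp only [wf, Bool.and_eq_true] at hs
    simp only [eval, he l ρ τ hl hs.1 h, hf l ρ τ hl hs.2 h]
  | sub e f he hf =>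
    intro l ρ τ hl hs h
    simp only [wf, Bool.and_eq_true] at hs
    simp only [eval, he l ρ τ hl hs.1 h, hf l ρ τ hl hs.2 h]
  | ite c e f hc he hf =>
    intro l ρ τ hl hs h
    simp only [wf, Bool.and_eq_true] at hs
    simp only [eval, hc l ρ τ hl hs.1.1 h, he l ρ τ hl hs.1.2 h, hf l ρ τ hl hs.2 h]
  | sum x e he =>
    intro l ρ τ hl hs h
    simp only [wf, Bool.and_eq_true] at hs
    simp only [eval, h 0 hl]
    refine Finset.sum_congr rfl fun i _ => he _ _ _ (List.mem_cons_of_mem _ hl) hs.2 fun y hy => ?_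
    by_cases hyx : y = x
    · simp [hyx]
    · rw [Function.update_of_ne hyx, Function.update_of_ne hyx]
      exact h y (by simpa [hyx] using hy)

end Term

/-- Commands: stores, compositions, conditionals and loops over `{0, …, n - 1}`, where `n` is the
value of the variable `0`.  Only arrays are changed by a command; `loop x p` binds `x` in `p`. -/
inductive Cmd where
  | store (a : ℕ) (i j e : Term)
  | seq (p q : Cmd)
  | ite (c : Term) (p : Cmd)
  | loop (x : ℕ) (p : Cmd)

/-- `iterate f n A` applies `f 0`, …, `f (n - 1)` in turn to `A`. -/
def iterate {α : Type*} (f : ℕ → α → α) : ℕ → α → α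
  | 0, A => A
  | n + 1, A => f n (iterate f n A)

/-- The arrays after the assignment of `c` to the entry `(i, j)` of array `a`. -/
def Arrays.set (A : Arrays) (a i j c : ℕ) : Arrays :=
  fun a' i' j' => if a' = a ∧ i' = i ∧ j' = j then c else A a' i' j'

namespace Cmd

/-- The arrays after the execution of a command in the environment `ρ`. -/
def den : Cmd → (ℕ → ℕ) → Arrays → Arrays
  | store a i j e, ρ, A => A.set a (i.eval A ρ) (j.eval A ρ) (e.eval A ρ)
  | seq p q, ρ, A => q.den ρ (p.den ρ A)
  | ite c p, ρ, A => if c.eval A ρ ≠ 0 then p.den ρ A else A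
  | loop x p, ρ, A => iterate (fun i B => p.den (Function.update ρ x i) B) (ρ 0) A

/-- The analogue for commands of `Term.wf`: in addition, array `5` is not written. -/
def wf : Cmd → List ℕ → Bool
  | store a i j e, l => a != 5 && i.wf l && j.wf l && e.wf l
  | seq p q, l => p.wf l && q.wf l
  | ite c p, l => c.wf l && p.wf l
  | loop x p, l => !l.contains x && p.wf (x :: l)

theorem den_congr : ∀ (p : Cmd) (l : List ℕ) (ρ τ : ℕ → ℕ) (A B : Arrays), 0 ∈ l → p.wf l →
    (∀ x ∈ l, ρ x = τ x) → (∀ a, a ≠ 5 → A a = B a) →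
    ∀ a, a ≠ 5 → p.den ρ A a = p.den τ B a := by
  intro p
  induction p with
  | store b i j e =>
    intro l ρ τ A B hl hs h hA a ha
    simp only [wf, Bool.and_eq_true, bne_iff_ne] at hs
    simp only [den, Term.eval_congr hA i l ρ τ hl hs.1.1.2 h,
      Term.eval_congr hA j l ρ τ hl hs.1.2 h, Term.eval_congr hA e l ρ τ hl hs.2 h]
    funext i' j'
    simp only [Arrays.set, hA a ha]
  | seq p q hp hq =>
    intro l ρ τ A B hl hs h hA
    simp only [wf, Bool.and_eq_true] at hs
    exact hq l ρ τ _ _ hl hs.2 h (hp l ρ τ A B hl hs.1 h hA)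
  | ite c p hp =>
    intro l ρ τ A B hl hs h hA
    simp only [wf, Bool.and_eq_true] at hs
    simp only [den, Term.eval_congr hA c l ρ τ hl hs.1 h]
    split_ifs
    · exact hp l ρ τ A B hl hs.2 h hA
    · exact hA
  | loop x p hp =>
    intro l ρ τ A B hl hs h hA
    simp only [wf, Bool.and_eq_true] at hs
    simp only [den, h 0 hl]
    generalize τ 0 = n
    induction n with
    | zero => exact hA
    | succ n ih =>
      refine hp _ _ _ _ _ (List.mem_cons_of_mem _ hl) hs.2 (fun y hy => ?_) ih
      by_cases hyx : y = x
      · simp [hyx]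
      · rw [Function.update_of_ne hyx, Function.update_of_ne hyx]
        exact h y (by simpa [hyx] using hy)

end Cmd

/-! ### Compilation to the random access machine -/

/-- Reading the `k`-th cell for intermediate results. -/
def cell (k : ℕ) : Expr := .get 5 (.const k) (.const 0)

/-- Writing the `k`-th cell for intermediate results. -/
def putCell (k : ℕ) (e : Expr) : Program := .store 5 (.const k) (.const 0) e

/-- Executing `p` for `x = 0, …, n - 1`. -/
def forProgram (x : ℕ) (p : Program) : Program :=
  .seq (.assign x (.const 0))
    (.loop (.sub (.reg 0) (.reg x)) (.seq p (.assign x (.add (.reg x) (.const 1)))))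

/-- A program that computes the value of a term in the `k`-th cell, and that changes only registers
of bound variables and cells from the `k`-th on. -/
def Term.compile : Term → ℕ → Program
  | const c, k => putCell k (.const c)
  | var x, k => putCell k (.reg x)
  | get a i j, k =>
      .seq (i.compile k) (.seq (j.compile (k + 1)) (putCell k (.get a (cell k) (cell (k + 1)))))
  | add e f, k =>
      .seq (e.compile k) (.seq (f.compile (k + 1)) (putCell k (.add (cell k) (cell (k + 1)))))
  | sub e f, k =>
      .seq (e.compile k) (.seq (f.compile (k + 1)) (putCell k (.sub (cell k) (cell (k + 1)))))
  | ite c e f, k => .seq (c.compile k) (.ite (cell k) (e.compile k) (f.compile k))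
  | sum x e, k =>
      .seq (putCell k (.const 0))
        (forProgram x (.seq (e.compile (k + 1)) (putCell k (.add (cell k) (cell (k + 1))))))

/-- A program that executes a command. -/
def Cmd.compile : Cmd → Program
  | store a i j e => .seq (i.compile 0) (.seq (j.compile 1) (.seq (e.compile 2)
      (.store a (cell 0) (cell 1) (cell 2))))
  | seq p q => .seq p.compile q.compile
  | ite c p => .seq (c.compile 0) (.ite (cell 0) p.compile .skip)
  | loop x p => forProgram x p.compile

/-- The states agree on the registers in `l`, on the arrays other than array `5`, and on the cells
for intermediate results before the `k`-th one. -/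
structure Agree (l : List ℕ) (k : ℕ) (σ σ' : State) : Prop where
  reg : ∀ x ∈ l, σ'.reg x = σ.reg x
  arr : ∀ a, a ≠ 5 → σ'.arr a = σ.arr a
  cell : ∀ i < k, σ'.arr 5 i 0 = σ.arr 5 i 0

namespace Agree

variable {l : List ℕ} {k m : ℕ} {σ σ' σ'' : State}

theorem trans (h : Agree l k σ σ') (h' : Agree l k σ' σ'') : Agree l k σ σ'' :=
  ⟨fun x hx => (h'.reg x hx).trans (h.reg x hx), fun a ha => (h'.arr a ha).trans (h.arr a ha),
    fun i hi => (h'.cell i hi).trans (h.cell i hi)⟩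

theorem mono (h : Agree l m σ σ') (hk : k ≤ m) : Agree l k σ σ' :=
  ⟨h.reg, h.arr, fun i hi => h.cell i (hi.trans_le hk)⟩

theorem of_cons {x : ℕ} (h : Agree (x :: l) k σ σ') : Agree l k σ σ' :=
  ⟨fun y hy => h.reg y (List.mem_cons_of_mem _ hy), h.arr, h.cell⟩

theorem setArr (hkm : k ≤ m) (c : ℕ) : Agree l k σ (σ.setArr 5 m 0 c) := by
  refine ⟨fun _ _ => rfl, fun a ha => ?_, fun i hi => ?_⟩
  · funext i j
    simp [State.setArr, ha]
  · have : i ≠ m := by omega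
    simp [State.setArr, this]

theorem setReg {x : ℕ} (hx : x ∉ l) (c : ℕ) : Agree l k σ (σ.setReg x c) := by
  refine ⟨fun y hy => ?_, fun _ _ => rfl, fun _ _ => rfl⟩
  have : y ≠ x := by rintro rfl; exact hx hy
  simp [State.setReg, this]

end Agree

theorem runs_putCell (k : ℕ) (e : Expr) (σ : State) :
    Runs (putCell k e) σ (σ.setArr 5 k 0 (e.eval σ)) (e.cost + 3) := by
  have := Runs.store σ 5 (.const k) (.const 0) e
  simp only [Expr.cost, Expr.eval] at this
  rw [show 1 + 1 + e.cost + 1 = e.cost + 3 by ring] at this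
  exact this

/-- The loop rule for a loop whose body increments the counter `x`: an invariant that is indexed by
the counter, and a uniform bound `B` for the running time of the body. -/
theorem runs_loop {x n B : ℕ} {p : Program} (P : ℕ → State → Prop)
    (hP : ∀ i σ, P i σ → σ.reg 0 = n ∧ σ.reg x = i)
    (hp : ∀ i < n, ∀ σ, P i σ → ∃ σ' t, Runs p σ σ' t ∧ t ≤ B ∧ P (i + 1) σ') :
    ∀ m i σ, i + m = n → P i σ →
      ∃ σ' t, Runs (.loop (.sub (.reg 0) (.reg x)) p) σ σ' t ∧ t ≤ m * (B + 4) + 4 ∧ P n σ' := by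
  intro m
  induction m with
  | zero =>
    intro i σ hi h
    obtain rfl : i = n := by omega
    exact ⟨σ, _, Runs.loop_exit (by simp [Expr.eval, hP i σ h]), by simp [Expr.cost], h⟩
  | succ m ih =>
    intro i σ hi h
    obtain ⟨σ₁, t₁, h₁, ht₁, hP₁⟩ := hp i (by omega) σ h
    obtain ⟨σ₂, t₂, h₂, ht₂, hP₂⟩ := ih (i + 1) σ₁ (by omega) hP₁
    refine ⟨σ₂, _, Runs.loop_step ?_ h₁ h₂, ?_, hP₂⟩
    · simp only [Expr.eval, hP i σ h]
      omega
    · simp only [Expr.cost]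
      nlinarith

theorem runs_forProgram {x n B : ℕ} {p : Program} (hx : x ≠ 0) (P : ℕ → State → Prop)
    (hp : ∀ i < n, ∀ σ, P i σ → σ.reg 0 = n → σ.reg x = i →
      ∃ σ' t, Runs p σ σ' t ∧ t ≤ B ∧ σ'.reg 0 = n ∧ σ'.reg x = i ∧
        P (i + 1) (σ'.setReg x (i + 1)))
    (σ : State) (hn : σ.reg 0 = n) (h : P 0 (σ.setReg x 0)) :
    ∃ σ' t, Runs (forProgram x p) σ σ' t ∧ t ≤ n * (B + 8) + 6 ∧ P n σ' := by
  obtain ⟨σ', t, hr, ht, h'⟩ := runs_loop (x := x) (n := n) (B := B + 4)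
    (p := .seq p (.assign x (.add (.reg x) (.const 1))))
    (fun i σ => P i σ ∧ σ.reg 0 = n ∧ σ.reg x = i) (fun i σ h => h.2)
    (by
      rintro i hi σ ⟨h, h0, hxi⟩
      obtain ⟨σ', t, hr, ht, h0', hxi', h'⟩ := hp i hi σ h h0 hxi
      refine ⟨_, _, Runs.seq hr (Runs.assign _ _ _), ?_, ?_⟩
      · simp only [Expr.cost]
        omega
      · simp only [Expr.eval, hxi']
        exact ⟨h', by simp [State.setReg, hx.symm, h0'], by simp [State.setReg]⟩)
    n 0 (σ.setReg x 0) (by omega)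
    ⟨h, by simp [State.setReg, hx.symm, hn], by simp [State.setReg]⟩
  refine ⟨σ', _, Runs.seq (Runs.assign _ _ _) hr, ?_, h'.1⟩
  simp only [Expr.cost]
  have : n * (B + 4 + 4) = n * (B + 8) := rfl
  omega

theorem State.arr_setArr_self (σ : State) (a i j c : ℕ) : (σ.setArr a i j c).arr a i j = c := by
  simp [State.setArr]

/-- The compiled term computes the value of the term in polynomial time. -/
theorem Term.runs_compile : ∀ (e : Term) (l : List ℕ) (k : ℕ), 0 ∈ l → e.wf l →
    ∃ f : Polynomial ℕ, ∀ σ : State, ∃ σ' t, Runs (e.compile k) σ σ' t ∧ t ≤ f.eval (σ.reg 0) ∧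
      Agree l k σ σ' ∧ σ'.arr 5 k 0 = e.eval σ.arr σ.reg := by
  -- The three binary constructors are compiled in the same way.
  have binary : ∀ (e f : Term) (op : Expr → Expr → Expr) (l : List ℕ) (k : ℕ), 0 ∈ l →
      f.wf l → (op (cell k) (cell (k + 1))).cost = 7 →
      (∃ g : Polynomial ℕ, ∀ σ : State, ∃ σ' t, Runs (e.compile k) σ σ' t ∧
        t ≤ g.eval (σ.reg 0) ∧ Agree l k σ σ' ∧ σ'.arr 5 k 0 = e.eval σ.arr σ.reg) →
      (∃ g : Polynomial ℕ, ∀ σ : State, ∃ σ' t, Runs (f.compile (k + 1)) σ σ' t ∧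
        t ≤ g.eval (σ.reg 0) ∧ Agree l (k + 1) σ σ' ∧
        σ'.arr 5 (k + 1) 0 = f.eval σ.arr σ.reg) →
      ∃ g : Polynomial ℕ, ∀ σ : State, ∃ σ' σ'' t,
        Runs (.seq (e.compile k) (.seq (f.compile (k + 1))
          (putCell k (op (cell k) (cell (k + 1)))))) σ σ'' t ∧
        t ≤ g.eval (σ.reg 0) ∧ Agree l k σ σ' ∧ Agree l k σ σ'' ∧
        (cell k).eval σ' = e.eval σ.arr σ.reg ∧ (cell (k + 1)).eval σ' = f.eval σ.arr σ.reg ∧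
        σ''.arr 5 k 0 = (op (cell k) (cell (k + 1))).eval σ' := by
    rintro e f op l k hl hf hop ⟨g₁, h₁⟩ ⟨g₂, h₂⟩
    refine ⟨g₁ + g₂ + Polynomial.C 10, fun σ => ?_⟩
    obtain ⟨σ₁, t₁, r₁, ht₁, a₁, v₁⟩ := h₁ σ
    obtain ⟨σ₂, t₂, r₂, ht₂, a₂, v₂⟩ := h₂ σ₁
    have a := a₁.trans (a₂.mono (Nat.le_succ k))
    refine ⟨σ₂, _, _, Runs.seq r₁ (Runs.seq r₂ (runs_putCell _ _ _)), ?_, a,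
      a.trans (Agree.setArr le_rfl _), ?_, ?_, State.arr_setArr_self ..⟩
    · rw [a₁.reg 0 hl] at ht₂
      rw [hop]
      simp only [Polynomial.eval_add, Polynomial.eval_C]
      omega
    · simp only [cell, Expr.eval, a₂.cell k (Nat.lt_succ_self k), v₁]
    · simp only [cell, Expr.eval, v₂]
      exact Term.eval_congr a₁.arr f l _ _ hl hf a₁.reg
  intro e
  induction e with
  | const c =>
    intro l k _ _
    refine ⟨Polynomial.C 4, fun σ => ⟨_, _, runs_putCell _ _ _, by simp [Expr.cost],
      Agree.setArr le_rfl _, State.arr_setArr_self ..⟩⟩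
  | var x =>
    intro l k _ _
    refine ⟨Polynomial.C 4, fun σ => ⟨_, _, runs_putCell _ _ _, by simp [Expr.cost],
      Agree.setArr le_rfl _, State.arr_setArr_self ..⟩⟩
  | get a i j hi hj =>
    intro l k hl hs
    simp only [wf, Bool.and_eq_true, bne_iff_ne] at hs
    obtain ⟨g, h⟩ := binary i j (.get a) l k hl hs.2 (by simp [Expr.cost, cell])
      (hi l k hl hs.1.2) (hj l (k + 1) hl hs.2)
    refine ⟨g, fun σ => ?_⟩
    obtain ⟨σ', σ'', t, r, ht, a', a'', v₁, v₂, v⟩ := h σ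
    refine ⟨σ'', t, r, ht, a'', v.trans ?_⟩
    simp only [Expr.eval, eval, v₁, v₂, a'.arr a hs.1.1]
  | add e f he hf =>
    intro l k hl hs
    simp only [wf, Bool.and_eq_true] at hs
    obtain ⟨g, h⟩ := binary e f .add l k hl hs.2 (by simp [Expr.cost, cell])
      (he l k hl hs.1) (hf l (k + 1) hl hs.2)
    refine ⟨g, fun σ => ?_⟩
    obtain ⟨σ', σ'', t, r, ht, -, a'', v₁, v₂, v⟩ := h σ
    refine ⟨σ'', t, r, ht, a'', v.trans ?_⟩
    simp only [Expr.eval, eval, v₁, v₂]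
  | sub e f he hf =>
    intro l k hl hs
    simp only [wf, Bool.and_eq_true] at hs
    obtain ⟨g, h⟩ := binary e f .sub l k hl hs.2 (by simp [Expr.cost, cell])
      (he l k hl hs.1) (hf l (k + 1) hl hs.2)
    refine ⟨g, fun σ => ?_⟩
    obtain ⟨σ', σ'', t, r, ht, -, a'', v₁, v₂, v⟩ := h σ
    refine ⟨σ'', t, r, ht, a'', v.trans ?_⟩
    simp only [Expr.eval, eval, v₁, v₂]
  | ite c e f hc he hf =>
    intro l k hl hs
    simp only [wf, Bool.and_eq_true] at hs
    obtain ⟨g₁, h₁⟩ := hc l k hl hs.1.1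
    obtain ⟨g₂, h₂⟩ := he l k hl hs.1.2
    obtain ⟨g₃, h₃⟩ := hf l k hl hs.2
    refine ⟨g₁ + g₂ + g₃ + Polynomial.C 4, fun σ => ?_⟩
    obtain ⟨σ₁, t₁, r₁, ht₁, a₁, v₁⟩ := h₁ σ
    have hcell : (cell k).eval σ₁ = c.eval σ.arr σ.reg := by simp only [cell, Expr.eval, v₁]
    have hcost : (cell k).cost = 3 := rfl
    have h0 := a₁.reg 0 hl
    by_cases hce : c.eval σ.arr σ.reg ≠ 0
    · obtain ⟨σ₂, t₂, r₂, ht₂, a₂, v₂⟩ := h₂ σ₁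
      refine ⟨σ₂, _, Runs.seq r₁ (Runs.ite_true (by rwa [hcell]) r₂), ?_, a₁.trans a₂, ?_⟩
      · rw [h0] at ht₂
        simp only [Polynomial.eval_add, Polynomial.eval_C]
        omega
      · simp only [eval, if_pos hce, v₂]
        exact Term.eval_congr a₁.arr e l _ _ hl hs.1.2 a₁.reg
    · obtain ⟨σ₂, t₂, r₂, ht₂, a₂, v₂⟩ := h₃ σ₁
      refine ⟨σ₂, _, Runs.seq r₁ (Runs.ite_false (by rw [hcell]; simpa using hce) r₂), ?_,
        a₁.trans a₂, ?_⟩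
      · rw [h0] at ht₂
        simp only [Polynomial.eval_add, Polynomial.eval_C]
        omega
      · simp only [eval, if_neg hce, v₂]
        exact Term.eval_congr a₁.arr f l _ _ hl hs.2 a₁.reg
  | sum x e he =>
    intro l k hl hs
    simp only [wf, Bool.and_eq_true, Bool.not_eq_true', List.contains_eq_mem,
      decide_eq_false_iff_not] at hs
    have hx0 : x ≠ 0 := by rintro rfl; exact hs.1 hl
    have hl' : 0 ∈ x :: l := List.mem_cons_of_mem _ hl
    obtain ⟨g, h⟩ := he (x :: l) (k + 1) hl' hs.2
    refine ⟨Polynomial.X * (g + Polynomial.C 18) + Polynomial.C 10, fun σ => ?_⟩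
    obtain ⟨σ', t, r, ht, a, v⟩ := runs_forProgram (x := x) (n := σ.reg 0)
      (B := g.eval (σ.reg 0) + 10) hx0
      (p := .seq (e.compile (k + 1)) (putCell k (.add (cell k) (cell (k + 1)))))
      (fun i σ' => Agree l k σ σ' ∧ σ'.arr 5 k 0 =
        ∑ j ∈ Finset.range i, e.eval σ.arr (Function.update σ.reg x j))
      (by
        rintro i hi τ ⟨a, v⟩ h0 hxi
        obtain ⟨τ', t, r, ht, a', v'⟩ := h τ
        refine ⟨_, _, Runs.seq r (runs_putCell _ _ _), ?_, ?_, ?_, ?_, ?_⟩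
        · rw [h0] at ht
          simp only [Expr.cost, cell]
          omega
        · exact (a'.reg 0 hl').trans h0
        · exact (a'.reg x List.mem_cons_self).trans hxi
        · exact ((a.trans (a'.of_cons.mono (Nat.le_succ k))).trans (Agree.setArr le_rfl _)).trans
            (Agree.setReg hs.1 _)
        · refine (State.arr_setArr_self _ 5 k 0 _).trans ?_
          simp only [Expr.eval, cell, v', a'.cell k (Nat.lt_succ_self k), v]
          rw [Finset.sum_range_succ]
          congr 1
          refine Term.eval_congr a.arr e (x :: l) _ _ hl' hs.2 fun y hy => ?_
          by_cases hyx : y = x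
          · simp [hyx, hxi]
          · rw [Function.update_of_ne hyx]
            exact a.reg y (by simpa [hyx] using hy))
      (σ.setArr 5 k 0 0) rfl
      ⟨(Agree.setArr le_rfl _).trans (Agree.setReg hs.1 _), State.arr_setArr_self _ 5 k 0 0⟩
    refine ⟨σ', _, Runs.seq (runs_putCell k (.const 0) σ) r, ?_, a, v⟩
    simp only [Expr.cost, Polynomial.eval_add, Polynomial.eval_mul, Polynomial.eval_X,
      Polynomial.eval_C]
    have : σ.reg 0 * (Polynomial.eval (σ.reg 0) g + 10 + 8) =
      σ.reg 0 * (Polynomial.eval (σ.reg 0) g + 18) := rfl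
    omega

/-- The compiled command has the effect of the command, in polynomial time. -/
theorem Cmd.runs_compile : ∀ (p : Cmd) (l : List ℕ), 0 ∈ l → p.wf l →
    ∃ f : Polynomial ℕ, ∀ σ : State, ∃ σ' t, Runs p.compile σ σ' t ∧ t ≤ f.eval (σ.reg 0) ∧
      (∀ x ∈ l, σ'.reg x = σ.reg x) ∧ ∀ a, a ≠ 5 → σ'.arr a = p.den σ.reg σ.arr a := by
  intro p
  induction p with
  | store b i j e =>
    intro l hl hs
    simp only [wf, Bool.and_eq_true, bne_iff_ne] at hs
    obtain ⟨g₁, h₁⟩ := i.runs_compile l 0 hl hs.1.1.2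
    obtain ⟨g₂, h₂⟩ := j.runs_compile l 1 hl hs.1.2
    obtain ⟨g₃, h₃⟩ := e.runs_compile l 2 hl hs.2
    refine ⟨g₁ + g₂ + g₃ + Polynomial.C 10, fun σ => ?_⟩
    obtain ⟨σ₁, t₁, r₁, ht₁, a₁, v₁⟩ := h₁ σ
    obtain ⟨σ₂, t₂, r₂, ht₂, a₂, v₂⟩ := h₂ σ₁
    obtain ⟨σ₃, t₃, r₃, ht₃, a₃, v₃⟩ := h₃ σ₂
    have a₁₂ := a₁.trans (a₂.mono (Nat.zero_le 1))
    have a := a₁₂.trans (a₃.mono (Nat.zero_le 2))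
    refine ⟨_, _, Runs.seq r₁ (Runs.seq r₂ (Runs.seq r₃ (Runs.store _ _ _ _ _))), ?_,
      a.reg, fun c hc => ?_⟩
    · rw [a₁.reg 0 hl] at ht₂
      rw [a₁₂.reg 0 hl] at ht₃
      simp only [Polynomial.eval_add, Polynomial.eval_C, cell, Expr.cost]
      omega
    · have w₁ : σ₃.arr 5 0 0 = i.eval σ.arr σ.reg := by
        rw [a₃.cell 0 (by omega), a₂.cell 0 (by omega), v₁]
      have w₂ : σ₃.arr 5 1 0 = j.eval σ.arr σ.reg := by
        rw [a₃.cell 1 (by omega), v₂]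
        exact Term.eval_congr a₁.arr j l _ _ hl hs.1.2 a₁.reg
      have w₃ : σ₃.arr 5 2 0 = e.eval σ.arr σ.reg := by
        rw [v₃]
        exact Term.eval_congr a₁₂.arr e l _ _ hl hs.2 a₁₂.reg
      funext i' j'
      simp only [cell, Expr.eval, w₁, w₂, w₃, State.setArr, den, Arrays.set, a.arr c hc]
  | seq p q hp hq =>
    intro l hl hs
    simp only [wf, Bool.and_eq_true] at hs
    obtain ⟨g₁, h₁⟩ := hp l hl hs.1
    obtain ⟨g₂, h₂⟩ := hq l hl hs.2
    refine ⟨g₁ + g₂, fun σ => ?_⟩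
    obtain ⟨σ₁, t₁, r₁, ht₁, a₁, v₁⟩ := h₁ σ
    obtain ⟨σ₂, t₂, r₂, ht₂, a₂, v₂⟩ := h₂ σ₁
    refine ⟨σ₂, _, Runs.seq r₁ r₂, ?_, fun x hx => (a₂ x hx).trans (a₁ x hx), fun a ha => ?_⟩
    · rw [a₁ 0 hl] at ht₂
      simp only [Polynomial.eval_add]
      omega
    · exact (v₂ a ha).trans (den_congr q l _ _ _ _ hl hs.2 a₁ v₁ a ha)
  | ite c p hp =>
    intro l hl hs
    simp only [wf, Bool.and_eq_true] at hs
    obtain ⟨g₁, h₁⟩ := c.runs_compile l 0 hl hs.1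
    obtain ⟨g₂, h₂⟩ := hp l hl hs.2
    refine ⟨g₁ + g₂ + Polynomial.C 5, fun σ => ?_⟩
    obtain ⟨σ₁, t₁, r₁, ht₁, a₁, v₁⟩ := h₁ σ
    have hcell : (cell 0).eval σ₁ = c.eval σ.arr σ.reg := by simp only [cell, Expr.eval, v₁]
    have hcost : (cell 0).cost = 3 := rfl
    by_cases hce : c.eval σ.arr σ.reg ≠ 0
    · obtain ⟨σ₂, t₂, r₂, ht₂, a₂, v₂⟩ := h₂ σ₁
      refine ⟨σ₂, _, Runs.seq r₁ (Runs.ite_true (by rwa [hcell]) r₂), ?_,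
        fun x hx => (a₂ x hx).trans (a₁.reg x hx), fun a ha => ?_⟩
      · rw [a₁.reg 0 hl] at ht₂
        simp only [Polynomial.eval_add, Polynomial.eval_C]
        omega
      · simp only [den, if_pos hce]
        exact (v₂ a ha).trans (den_congr p l _ _ _ _ hl hs.2 a₁.reg a₁.arr a ha)
    · refine ⟨σ₁, _, Runs.seq r₁ (Runs.ite_false (by rw [hcell]; simpa using hce) (Runs.skip _)),
        ?_, a₁.reg, fun a ha => ?_⟩
      · simp only [Polynomial.eval_add, Polynomial.eval_C]
        omega
      · simp only [den, if_neg hce]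
        exact a₁.arr a ha
  | loop x p hp =>
    intro l hl hs
    simp only [wf, Bool.and_eq_true, Bool.not_eq_true', List.contains_eq_mem,
      decide_eq_false_iff_not] at hs
    have hx0 : x ≠ 0 := by rintro rfl; exact hs.1 hl
    have hl' : 0 ∈ x :: l := List.mem_cons_of_mem _ hl
    obtain ⟨g, h⟩ := hp (x :: l) hl' hs.2
    refine ⟨Polynomial.X * (g + Polynomial.C 8) + Polynomial.C 6, fun σ => ?_⟩
    obtain ⟨σ', t, r, ht, a, v⟩ := runs_forProgram (x := x) (n := σ.reg 0)
      (B := g.eval (σ.reg 0)) hx0 (p := p.compile)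
      (fun i σ' => (∀ y ∈ l, σ'.reg y = σ.reg y) ∧ ∀ a, a ≠ 5 → σ'.arr a =
        iterate (fun i B => p.den (Function.update σ.reg x i) B) i σ.arr a)
      (by
        rintro i hi τ ⟨a, v⟩ h0 hxi
        obtain ⟨τ', t, r, ht, a', v'⟩ := h τ
        rw [h0] at ht
        refine ⟨_, _, r, ht, (a' 0 hl').trans h0, (a' x List.mem_cons_self).trans hxi,
          fun y hy => ?_, fun b hb => ?_⟩
        · have : y ≠ x := by rintro rfl; exact hs.1 hy
          simp only [State.setReg, Function.update_of_ne this]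
          exact (a' y (List.mem_cons_of_mem _ hy)).trans (a y hy)
        · refine (v' b hb).trans (den_congr p _ _ _ _ _ hl' hs.2 (fun y hy => ?_) v b hb)
          by_cases hyx : y = x
          · simp [hyx, hxi]
          · rw [Function.update_of_ne hyx]
            exact a y (by simpa [hyx] using hy))
      σ rfl
      ⟨fun y hy => by
          have : y ≠ x := by rintro rfl; exact hs.1 hy
          simp only [State.setReg, Function.update_of_ne this], fun _ _ => rfl⟩
    refine ⟨σ', t, r, ?_, a, v⟩
    simp only [Polynomial.eval_add, Polynomial.eval_mul, Polynomial.eval_X, Polynomial.eval_C]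
    exact ht

/-! ### Subdivided stars are trees with a single branching vertex -/

section Star

variable {d : ℕ} {len : Fin d → ℕ}

/-- The distance of a vertex of a subdivided star from the center. -/
def starHeight : Option (Σ j : Fin d, Fin (len j)) → ℕ
  | none => 0
  | some p => p.2 + 1

theorem subdividedStar_adj_none {q : Σ j : Fin d, Fin (len j)} :
    (subdividedStar len).Adj none (some q) ↔ (q.2 : ℕ) = 0 := by
  simp [subdividedStar]

theorem subdividedStar_adj_some {p q : Σ j : Fin d, Fin (len j)} :
    (subdividedStar len).Adj (some p) (some q) ↔
      p.1 = q.1 ∧ ((p.2 : ℕ) + 1 = q.2 ∨ (q.2 : ℕ) + 1 = p.2) := by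
  simp only [subdividedStar, SimpleGraph.fromRel_adj]
  constructor
  · rintro ⟨-, ⟨h, h'⟩ | ⟨h, h'⟩⟩
    · exact ⟨h, Or.inl h'⟩
    · exact ⟨h.symm, Or.inr h'⟩
  · rintro ⟨h, h'⟩
    refine ⟨?_, h'.imp (fun h' => ⟨h, h'⟩) fun h' => ⟨h.symm, h'⟩⟩
    rintro heq
    obtain rfl := Option.some.inj heq
    omega

theorem sigma_fin_ext {p q : Σ j : Fin d, Fin (len j)} (h : p.1 = q.1) (h' : (p.2 : ℕ) = q.2) :
    p = q := by
  obtain ⟨j, i⟩ := p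
  obtain ⟨j', i'⟩ := q
  obtain rfl : j = j' := h
  obtain rfl : i = i' := Fin.ext h'
  rfl

/-- A vertex has at most one neighbor that is not farther from the center. -/
theorem eq_of_adj_of_starHeight_le {x y v : Option (Σ j : Fin d, Fin (len j))}
    (hx : (subdividedStar len).Adj v x) (hy : (subdividedStar len).Adj v y)
    (hxv : starHeight x ≤ starHeight v) (hyv : starHeight y ≤ starHeight v) : x = y := by
  rcases v with _ | v
  · rcases x with _ | x
    · simp at hx
    · simp [starHeight] at hxv
  · rcases x with _ | x <;> rcases y with _ | y
    · rfl
    · have := subdividedStar_adj_none.1 hx.symm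
      have := subdividedStar_adj_some.1 hy
      simp only [starHeight] at hyv
      omega
    · have := subdividedStar_adj_none.1 hy.symm
      have := subdividedStar_adj_some.1 hx
      simp only [starHeight] at hxv
      omega
    · have hx := subdividedStar_adj_some.1 hx
      have hy := subdividedStar_adj_some.1 hy
      simp only [starHeight] at hxv hyv
      rw [sigma_fin_ext (p := x) (q := y) (hx.1.symm.trans hy.1) (by omega)]

/-- A vertex other than the center has at most one neighbor that is not closer to the center. -/
theorem eq_of_adj_of_le_starHeight {x y v : Option (Σ j : Fin d, Fin (len j))} (hv : v ≠ none)
    (hx : (subdividedStar len).Adj v x) (hy : (subdividedStar len).Adj v y)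
    (hxv : starHeight v ≤ starHeight x) (hyv : starHeight v ≤ starHeight y) : x = y := by
  rcases v with _ | v
  · exact absurd rfl hv
  · rcases x with _ | x
    · simp [starHeight] at hxv
    rcases y with _ | y
    · simp [starHeight] at hyv
    have hx := subdividedStar_adj_some.1 hx
    have hy := subdividedStar_adj_some.1 hy
    simp only [starHeight] at hxv hyv
    rw [sigma_fin_ext (p := x) (q := y) (hx.1.symm.trans hy.1) (by omega)]

theorem subdividedStar_isAcyclic : (subdividedStar len).IsAcyclic := by
  classical
  intro u w hw
  -- A vertex of maximal height on a cycle would have two distinct lower neighbors.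
  obtain ⟨v, hv, hmax⟩ := w.support.toFinset.exists_max_image starHeight
    ⟨u, by simp⟩
  rw [List.mem_toFinset] at hv
  have hc := hw.rotate hv
  have hle : ∀ x ∈ (w.rotate v hv).support, starHeight x ≤ starHeight v := by
    intro x hx
    exact hmax x (by rwa [List.mem_toFinset, ← SimpleGraph.Walk.mem_support_rotate_iff w v hv])
  exact hc.snd_ne_penultimate (eq_of_adj_of_starHeight_le
    (SimpleGraph.Walk.adj_snd hc.not_nil) (SimpleGraph.Walk.adj_penultimate hc.not_nil).symm
    (hle _ (SimpleGraph.Walk.getVert_mem_support _ _))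
    (hle _ (SimpleGraph.Walk.getVert_mem_support _ _)))

theorem subdividedStar_reachable (x : Option (Σ j : Fin d, Fin (len j))) :
    (subdividedStar len).Reachable none x := by
  rcases x with _ | ⟨j, i, hi⟩
  · exact SimpleGraph.Reachable.refl _
  · induction i with
    | zero => exact (subdividedStar_adj_none.2 rfl).reachable
    | succ i ih =>
      exact (ih (by omega)).trans
        (subdividedStar_adj_some (p := ⟨j, i, by omega⟩) (q := ⟨j, i + 1, hi⟩) |>.2
          ⟨rfl, Or.inl rfl⟩).reachable

theorem subdividedStar_isTree : (subdividedStar len).IsTree where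
  connected := ⟨fun x y => (subdividedStar_reachable x).symm.trans (subdividedStar_reachable y)⟩
  isAcyclic := subdividedStar_isAcyclic

end Star

/-- Every vertex other than `c` has at most two neighbors. -/
def OnlyBranchesAt {V : Type*} (G : SimpleGraph V) (c : V) : Prop :=
  ∀ w x y z, w ≠ c → G.Adj w x → G.Adj w y → G.Adj w z → x = y ∨ x = z ∨ y = z

theorem subdividedStar_onlyBranchesAt {d : ℕ} (len : Fin d → ℕ) :
    OnlyBranchesAt (subdividedStar len) none := by
  intro w x y z hw hx hy hz
  -- Two of the three neighbors are on the same side of `w`.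
  rcases le_total (starHeight x) (starHeight w) with h | h <;>
  rcases le_total (starHeight y) (starHeight w) with h' | h' <;>
  rcases le_total (starHeight z) (starHeight w) with h'' | h''
  · exact Or.inl (eq_of_adj_of_starHeight_le hx hy h h')
  · exact Or.inl (eq_of_adj_of_starHeight_le hx hy h h')
  · exact Or.inr (Or.inl (eq_of_adj_of_starHeight_le hx hz h h''))
  · exact Or.inr (Or.inr (eq_of_adj_of_le_starHeight hw hy hz h' h''))
  · exact Or.inr (Or.inr (eq_of_adj_of_starHeight_le hy hz h' h''))
  · exact Or.inr (Or.inl (eq_of_adj_of_le_starHeight hw hx hz h h''))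
  · exact Or.inl (eq_of_adj_of_le_starHeight hw hx hy h h')
  · exact Or.inl (eq_of_adj_of_le_starHeight hw hx hy h h')

theorem IsKStar.isTree_and_onlyBranchesAt {V : Type*} {k : ℕ} {G : SimpleGraph V}
    (h : IsKStar k G) : G.IsTree ∧ ∃ c, OnlyBranchesAt G c := by
  obtain ⟨d, len, -, ⟨φ⟩⟩ := h
  refine ⟨φ.isTree_iff.2 subdividedStar_isTree, φ.symm none, ?_⟩
  intro w x y z hw hx hy hz
  have := subdividedStar_onlyBranchesAt len (φ w) (φ x) (φ y) (φ z)
    (fun h => hw (by rw [← h, RelIso.symm_apply_apply]))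
    (φ.map_adj_iff.2 hx) (φ.map_adj_iff.2 hy) (φ.map_adj_iff.2 hz)
  simpa using this

/-! ### Descendants in rooted trees -/

section Below

variable {V : Type*} {G : SimpleGraph V} {s a b x y z v : V}

/-- `a` lies on a shortest path from the root `s` to `b`; in a tree this means that `b` is a
descendant of `a` (or `a` itself). -/
def Below (G : SimpleGraph V) (s a b : V) : Prop :=
  G.dist s a + G.dist a b = G.dist s b

theorem Below.refl (G : SimpleGraph V) (s a : V) : Below G s a a := by simp [Below]

theorem below_root (G : SimpleGraph V) (s b : V) : Below G s s b := by simp [Below]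

theorem Below.dist_le (h : Below G s a b) : G.dist s a ≤ G.dist s b := Nat.le.intro h

theorem below_of_adj_of_dist (hab : G.Adj a b) (h : G.dist s b = G.dist s a + 1) :
    Below G s a b := by
  rw [Below, h, SimpleGraph.dist_eq_one_iff_adj.2 hab]

variable (hG : G.IsTree)
include hG

theorem Below.trans (h : Below G s a b) (h' : Below G s b x) : Below G s a x := by
  have h₁ := hG.connected.dist_triangle (u := s) (v := a) (w := x)
  have h₂ := hG.connected.dist_triangle (u := a) (v := b) (w := x)
  unfold Below at *
  omega

theorem Below.eq_of_dist_le (h : Below G s a b) (h' : G.dist s b ≤ G.dist s a) : a = b := by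
  unfold Below at h
  exact hG.connected.dist_eq_zero_iff.1 (by omega)

theorem Below.antisymm (h : Below G s a b) (h' : Below G s b a) : a = b :=
  h.eq_of_dist_le hG h'.dist_le

/-- Every walk from the root to a vertex passes through the ancestors of the vertex. -/
theorem Below.mem_support (h : Below G s a b) (w : G.Walk s b) : a ∈ w.support := by
  classical
  obtain ⟨p, hp⟩ := hG.connected.exists_walk_length_eq_dist s a
  obtain ⟨q, hq⟩ := hG.connected.exists_walk_length_eq_dist a b
  have hpq : (p.append q).IsPath := SimpleGraph.Walk.isPath_of_length_eq_dist _ (by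
    rw [SimpleGraph.Walk.length_append, hp, hq, h])
  have := (hG.isAcyclic.subsingleton_path s b).elim ⟨_, hpq⟩ w.toPath
  have hmem : a ∈ (p.append q).support := by
    rw [SimpleGraph.Walk.mem_support_append_iff]
    exact Or.inl p.end_mem_support
  rw [show p.append q = w.bypass from congrArg Subtype.val this] at hmem
  exact w.support_bypass_subset_support hmem

theorem below_of_mem_support {p : G.Walk s b} (hp : p.length = G.dist s b)
    (ha : a ∈ p.support) : Below G s a b := by
  classical
  have h₁ := SimpleGraph.dist_le (p.takeUntil a ha)
  have h₂ := SimpleGraph.dist_le (p.dropUntil a ha)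
  have h₃ := congrArg SimpleGraph.Walk.length (p.take_spec ha)
  rw [SimpleGraph.Walk.length_append] at h₃
  have h₄ := hG.connected.dist_triangle (u := s) (v := a) (w := b)
  unfold Below
  omega

/-- The ancestors of a vertex form a chain. -/
theorem Below.total (ha : Below G s a x) (hb : Below G s b x) :
    Below G s a b ∨ Below G s b a := by
  obtain ⟨p, hp⟩ := hG.connected.exists_walk_length_eq_dist s a
  obtain ⟨q, hq⟩ := hG.connected.exists_walk_length_eq_dist a x
  have hmem := hb.mem_support hG (p.append q)
  rw [SimpleGraph.Walk.mem_support_append_iff] at hmem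
  rcases hmem with hmem | hmem
  · exact Or.inr (below_of_mem_support hG hp hmem)
  · left
    classical
    have h₁ := SimpleGraph.dist_le (q.takeUntil b hmem)
    have h₂ := SimpleGraph.dist_le (q.dropUntil b hmem)
    have h₃ := congrArg SimpleGraph.Walk.length (q.take_spec hmem)
    rw [SimpleGraph.Walk.length_append] at h₃
    have h₄ := hG.connected.dist_triangle (u := a) (v := b) (w := x)
    have h₅ := hG.connected.dist_triangle (u := s) (v := a) (w := b)
    unfold Below at *
    omega

/-- The subtree of `v` is entered only through `v`. -/
theorem Below.eq_of_adj (hab : G.Adj a b) (hb : Below G s v b) (ha : ¬ Below G s v a) : v = b := by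
  obtain ⟨p, hp⟩ := hG.connected.exists_walk_length_eq_dist s a
  have hmem := hb.mem_support hG (p.concat hab)
  rw [SimpleGraph.Walk.support_concat, List.mem_append] at hmem
  rcases hmem with hmem | hmem
  · exact absurd (below_of_mem_support hG hp hmem) ha
  · simpa using hmem

theorem Below.mem_support_of_not_below (hb : Below G s v b) (ha : ¬ Below G s v a)
    (w : G.Walk a b) : v ∈ w.support := by
  induction w with
  | nil => exact absurd hb ha
  | @cons a a' b h p ih =>
    by_cases ha' : Below G s v a'
    · rw [Below.eq_of_adj hG h ha' ha, SimpleGraph.Walk.support_cons]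
      exact List.mem_cons_of_mem _ p.start_mem_support
    · rw [SimpleGraph.Walk.support_cons]
      exact List.mem_cons_of_mem _ (ih hb ha')

theorem Below.exists_child (h : Below G s a x) (hne : a ≠ x) :
    ∃ b, G.Adj a b ∧ Below G s a b ∧ Below G s b x ∧ G.dist s b = G.dist s a + 1 := by
  obtain ⟨p, hp⟩ := hG.connected.exists_walk_length_eq_dist a x
  cases p with
  | nil => exact absurd rfl hne
  | @cons _ b _ hab q =>
    rw [SimpleGraph.Walk.length_cons] at hp
    have h₁ := SimpleGraph.dist_le q
    have h₂ := hG.connected.dist_triangle (u := s) (v := b) (w := x)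
    have h₃ := hG.connected.dist_triangle (u := s) (v := a) (w := b)
    have h₄ := SimpleGraph.dist_eq_one_iff_adj.2 hab
    refine ⟨b, hab, ?_⟩
    unfold Below at *
    omega

theorem exists_parent (h : z ≠ s) : ∃ b, G.Adj b z ∧ G.dist s z = G.dist s b + 1 := by
  obtain ⟨p, hp⟩ := hG.connected.exists_walk_length_eq_dist z s
  cases p with
  | nil => exact absurd rfl h
  | @cons _ b _ hzb q =>
    rw [SimpleGraph.Walk.length_cons] at hp
    have h₁ := SimpleGraph.dist_le q
    have h₃ := hG.connected.dist_triangle (u := s) (v := b) (w := z)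
    have h₄ := SimpleGraph.dist_eq_one_iff_adj.2 hzb.symm
    rw [SimpleGraph.dist_comm] at hp h₁
    exact ⟨b, hzb.symm, by omega⟩

/-- If only `c` has more than two neighbors, then two incomparable descendants of `z`, which is
not the root, branch off at `c`. -/
theorem OnlyBranchesAt.below_of_incomparable [Finite V] {c : V} (hc : OnlyBranchesAt G c)
    (hzs : z ≠ s) (hx : Below G s z x) (hy : Below G s z y) (hxy : ¬ Below G s x y)
    (hyx : ¬ Below G s y x) :
    Below G s z c ∧ Below G s c x ∧ Below G s c y ∧ c ≠ x ∧ c ≠ y := by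
  -- The last common ancestor `w` has a parent and distinct children towards `x` and `y`.
  obtain ⟨w, ⟨hwx, hwy⟩, hmax⟩ := Set.exists_max_image {w | Below G s w x ∧ Below G s w y}
    (fun w => G.dist s w) (Set.toFinite _) ⟨z, hx, hy⟩
  have hzw : Below G s z w := by
    rcases hx.total hG hwx with h | h
    · exact h
    · rw [h.eq_of_dist_le hG (hmax z ⟨hx, hy⟩)]
      exact Below.refl G s z
  have hwx' : w ≠ x := by rintro rfl; exact hxy hwy
  have hwy' : w ≠ y := by rintro rfl; exact hyx hwx
  have hws : w ≠ s := by
    rintro rfl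
    have := hzw.dist_le
    rw [SimpleGraph.dist_self, Nat.le_zero, hG.connected.dist_eq_zero_iff] at this
    exact hzs this.symm
  obtain ⟨x', h₁, -, hx'x, hx'⟩ := hwx.exists_child hG hwx'
  obtain ⟨y', h₂, -, hy'y, hy'⟩ := hwy.exists_child hG hwy'
  obtain ⟨p, h₃, hp⟩ := exists_parent hG hws
  suffices h : w = c by subst h; exact ⟨hzw, hwx, hwy, hwx', hwy'⟩
  by_contra hwc
  rcases hc w x' y' p hwc h₁ h₂ h₃.symm with rfl | rfl | rfl
  · have := hmax x' ⟨hx'x, hy'y⟩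
    omega
  · omega
  · omega

end Below

/-! ### Strategies in trees -/

section Strategy

variable {I : Instance} {Φ Ψ : I.Strategy} {q v w : Fin I.n} {t : ℕ}

theorem source_mem_burned (Φ : I.Strategy) : ∀ t, I.source ∈ I.burned Φ t
  | 0 => rfl
  | t + 1 => Or.inl (source_mem_burned Φ t)

theorem burned_mono {t t' : ℕ} (h : t ≤ t') : I.burned Φ t ⊆ I.burned Φ t' := by
  induction h with
  | refl => exact subset_rfl
  | step _ ih => exact ih.trans Set.subset_union_left

variable (hG : I.graph.IsTree)

include hG in
/-- The fire advances by at most one edge per time step, and starts to spread at time `2`. -/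
theorem dist_lt_of_mem_burned : ∀ {t : ℕ} {v : Fin I.n}, v ∈ I.burned Φ t →
    v = I.source ∨ I.graph.dist I.source v < t
  | 0, v, h => Or.inl h
  | t + 1, v, h => by
    rcases h with h | ⟨ht, -, u, hu, huv⟩
    · exact (dist_lt_of_mem_burned h).imp_right fun h => by omega
    · right
      have h₁ := hG.connected.dist_triangle (u := I.source) (v := u) (w := v)
      rw [SimpleGraph.dist_eq_one_iff_adj.2 huv] at h₁
      rcases dist_lt_of_mem_burned hu with rfl | h
      · rw [SimpleGraph.dist_self] at h₁
        omega
      · omega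

include hG in
/-- The fire reaches a vertex as soon as possible unless the vertex has been protected by then or
an ancestor is protected at some time. -/
theorem mem_burned_of_not_protected : ∀ (d : ℕ) (v : Fin I.n), I.graph.dist I.source v = d →
    (∀ a, Below I.graph I.source a v → a ≠ v → ∀ t, (a, t) ∉ Φ) →
    ¬ I.ProtectedBy Φ d v → v ∈ I.burned Φ (d + 1)
  | 0, v, hd, _, _ => by
    rw [hG.connected.dist_eq_zero_iff] at hd
    exact hd ▸ source_mem_burned Φ 1
  | d + 1, v, hd, ha, hv => by
    have hvs : v ≠ I.source := by
      rintro rfl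
      simp at hd
    obtain ⟨p, hpv, hp⟩ := exists_parent hG hvs
    have hp' : I.graph.dist I.source p = d := by omega
    have hbelow := below_of_adj_of_dist hpv hp
    have hne : ∀ a, Below I.graph I.source a p → a ≠ v := by
      rintro a h rfl
      have := h.dist_le
      omega
    refine Or.inr ⟨by omega, hv, p, mem_burned_of_not_protected d p hp' (fun a h _ => ?_) ?_, hpv⟩
    · exact ha a (h.trans hG hbelow) (hne a h)
    · rintro ⟨t, -, ht⟩
      exact ha p hbelow hpv.ne t ht

open Classical in
/-- The number of targets in the subtree of `v`, with respect to the root `I.source`. -/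
noncomputable def Instance.gain (I : Instance) (v : Fin I.n) : ℕ :=
  (I.targets.filter fun u => Below I.graph I.source v u).card

/-- `v` and `w` are in the same component after the removal of the path from the source
to `q`. -/
def SameLeg (I : Instance) (q v w : Fin I.n) : Prop :=
  ∃ z, ¬ Below I.graph I.source z q ∧ Below I.graph I.source z v ∧ Below I.graph I.source z w

/-- A strategy that protects no vertex on the path from the source to `q` and at most one vertex in
each of the components that remain when this path is removed, and that protects each vertex before
the fire could possibly reach it. -/
structure IsSelection (I : Instance) (q : Fin I.n) (M : I.Strategy) : Prop where
  one_le : ∀ v t, (v, t) ∈ M → 1 ≤ t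
  le_dist : ∀ v t, (v, t) ∈ M → t ≤ I.graph.dist I.source v
  not_forbidden : ∀ v t, (v, t) ∈ M → (v, t) ∉ I.forbidden
  not_below : ∀ v t, (v, t) ∈ M → ¬ Below I.graph I.source v q
  card_le : ∀ t, 1 ≤ t → t ≤ I.n → (M.filter fun p => p.2 = t).card ≤ I.budget t
  eq_of_sameLeg : ∀ p ∈ M, ∀ p' ∈ M, SameLeg I q p.1 p'.1 → p = p'

theorem ne_source_of_not_below (h : ¬ Below I.graph I.source v q) : v ≠ I.source := by
  rintro rfl
  exact h (below_root _ _ _)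

include hG in
theorem dist_lt_card (v w : Fin I.n) : I.graph.dist v w < I.n := by
  obtain ⟨p, hp, hd⟩ := hG.connected.exists_path_of_dist v w
  have := hp.length_lt
  rwa [hd, Fintype.card_fin] at this

include hG in
theorem IsSelection.isValid (h : IsSelection I q Φ) : I.IsValid Φ := by
  refine ⟨fun v t hvt => ⟨h.one_le v t hvt, ?_, fun hb => ?_, h.not_forbidden v t hvt⟩, h.card_le⟩
  · exact (h.le_dist v t hvt).trans (dist_lt_card hG _ _).le
  · have := h.le_dist v t hvt
    rcases dist_lt_of_mem_burned hG hb with hb | hb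
    · exact ne_source_of_not_below (h.not_below v t hvt) hb
    · omega

include hG in
/-- The fire never enters the subtree of a vertex that is protected in time. -/
theorem not_below_of_mem_burned (hv : (v, t) ∈ Φ) (hvs : v ≠ I.source)
    (ht : t ≤ I.graph.dist I.source v) :
    ∀ {t' : ℕ} {w : Fin I.n}, w ∈ I.burned Φ t' → ¬ Below I.graph I.source v w
  | 0, w, h => by
    obtain rfl : w = I.source := h
    exact fun h => hvs (h.antisymm hG (below_root _ _ _))
  | t' + 1, w, h => by
    intro hvw
    by_cases hw : w ∈ I.burned Φ t'
    · exact not_below_of_mem_burned hv hvs ht hw hvw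
    rcases h with h | ⟨ht', hp, u, hu, huw⟩
    · exact hw h
    · obtain rfl := Below.eq_of_adj hG huw hvw (not_below_of_mem_burned hv hvs ht hu)
      have hb : v ∈ I.burned Φ (t' + 1) := Or.inr ⟨ht', hp, u, hu, huw⟩
      rcases dist_lt_of_mem_burned hG hb with hb | hb
      · exact hvs hb
      · exact hp ⟨t, by omega, hv⟩

include hG in
/-- The subtrees of the vertices in a selection are disjoint, and they are saved. -/
theorem IsSelection.sum_gain_le (h : IsSelection I q Φ) :
    ∑ p ∈ Φ, I.gain p.1 ≤ I.savedCount Φ := by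
  classical
  unfold Instance.gain
  rw [← Finset.card_biUnion, Instance.savedCount, ← Set.ncard_coe_finset]
  · refine Set.ncard_le_ncard ?_ (Set.toFinite _)
    intro u hu
    simp only [Finset.coe_biUnion, Finset.mem_coe, Set.mem_iUnion, Finset.mem_filter] at hu
    obtain ⟨⟨v, t⟩, hvt, hut, hvu⟩ := hu
    refine ⟨hut, Or.inr fun b hb w _ => ⟨v, ?_, t, ?_, hvt⟩⟩
    · exact hvu.mem_support_of_not_below hG (not_below_of_mem_burned hG hvt
        (ne_source_of_not_below (h.not_below v t hvt)) (h.le_dist v t hvt) hb) w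
    · exact (h.le_dist v t hvt).trans (dist_lt_card hG _ _).le
  · intro p hp p' hp' hne
    refine Finset.disjoint_left.2 fun u hu hu' => hne ?_
    rw [Finset.mem_filter] at hu hu'
    rcases hu.2.total hG hu'.2 with hb | hb
    · exact h.eq_of_sameLeg p hp p' hp' ⟨p.1, h.not_below _ p.2 hp, Below.refl _ _ _, hb⟩
    · exact h.eq_of_sameLeg p hp p' hp' ⟨p'.1, h.not_below _ p'.2 hp', hb, Below.refl _ _ _⟩

open Classical in
/-- The protections `(v, t)` of a strategy such that `t` is the first time at which `v` is
protected, and no proper ancestor of `v` is ever protected. -/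
noncomputable def exposed (Ψ : I.Strategy) : I.Strategy :=
  Ψ.filter fun p => (∀ a, Below I.graph I.source a p.1 → a ≠ p.1 → ∀ t, (a, t) ∉ Ψ) ∧
    ∀ t, (p.1, t) ∈ Ψ → p.2 ≤ t

theorem mem_exposed : (v, t) ∈ exposed Ψ ↔ (v, t) ∈ Ψ ∧
    (∀ a, Below I.graph I.source a v → a ≠ v → ∀ t, (a, t) ∉ Ψ) ∧ ∀ t', (v, t') ∈ Ψ → t ≤ t' := by
  classical
  simp [exposed]

include hG in
theorem exists_exposed (h : (v, t) ∈ Ψ) :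
    ∃ p ∈ exposed Ψ, Below I.graph I.source p.1 v := by
  obtain ⟨a, ⟨hav, ta, hta⟩, hmin⟩ := Set.exists_min_image
    {a | Below I.graph I.source a v ∧ ∃ t, (a, t) ∈ Ψ} (fun a => I.graph.dist I.source a)
    (Set.toFinite _) ⟨v, Below.refl _ _ _, t, h⟩
  classical
  have hex : ∃ t, (a, t) ∈ Ψ := ⟨ta, hta⟩
  refine ⟨(a, Nat.find hex), mem_exposed.2 ⟨Nat.find_spec hex, fun b hb hne t ht => ?_,
    fun t ht => Nat.find_min' hex ht⟩, hav⟩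
  exact hne (hb.eq_of_dist_le hG (hmin b ⟨hb.trans hG hav, t, ht⟩))

include hG in
theorem savedCount_le_sum_exposed (Ψ : I.Strategy) :
    I.savedCount Ψ ≤ ∑ p ∈ exposed Ψ, I.gain p.1 := by
  classical
  unfold Instance.gain
  refine le_trans ?_ Finset.card_biUnion_le
  rw [Instance.savedCount, ← Set.ncard_coe_finset]
  refine Set.ncard_le_ncard ?_ (Set.toFinite _)
  rintro u ⟨hu, hs⟩
  have hprot : ∃ x t, (x, t) ∈ Ψ ∧ Below I.graph I.source x u := by
    rcases hs with ⟨t, -, ht⟩ | hs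
    · exact ⟨u, t, ht, Below.refl _ _ _⟩
    · obtain ⟨p, hp, hd⟩ := hG.connected.exists_path_of_dist I.source u
      obtain ⟨x, hx, t, -, ht⟩ := hs I.source (source_mem_burned Ψ _) p hp
      exact ⟨x, t, ht, below_of_mem_support hG hd hx⟩
  obtain ⟨x, t, ht, hx⟩ := hprot
  obtain ⟨p, hp, hpx⟩ := exists_exposed hG ht
  simp only [Finset.coe_biUnion, Finset.mem_coe, Set.mem_iUnion, Finset.mem_filter]
  exact ⟨p, hp, hu, hpx.trans hG hx⟩

theorem eq_of_mem_exposed_of_below {p p' : Fin I.n × ℕ} (hp : p ∈ exposed Ψ)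
    (hp' : p' ∈ exposed Ψ) (h : Below I.graph I.source p.1 p'.1) : p = p' := by
  obtain ⟨v, t⟩ := p
  obtain ⟨v', t'⟩ := p'
  obtain ⟨hp, -, ht⟩ := mem_exposed.1 hp
  obtain ⟨hp', ha, ht'⟩ := mem_exposed.1 hp'
  obtain rfl : v = v' := by
    by_contra hne
    exact ha v h hne t hp
  rw [le_antisymm (ht t' hp') (ht' t hp)]

include hG in
/-- In a tree with a single branching vertex, every valid strategy is dominated by a
selection. -/
theorem exists_isSelection {c : Fin I.n} (hc : OnlyBranchesAt I.graph c) (hΨ : I.IsValid Ψ) :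
    ∃ q M, IsSelection I q M ∧ I.savedCount Ψ ≤ ∑ p ∈ M, I.gain p.1 := by
  have hsub : exposed Ψ ⊆ Ψ := fun p hp => (mem_exposed.1 hp).1
  -- Two exposed vertices that are not separated by the source are separated by the center, which
  -- is not below an exposed vertex.
  have hbranch : ∀ p ∈ exposed Ψ, ∀ p' ∈ exposed Ψ, p ≠ p' → ∀ z, z ≠ I.source →
      Below I.graph I.source z p.1 → Below I.graph I.source z p'.1 →
      Below I.graph I.source z c ∧ Below I.graph I.source c p.1 ∧ c ≠ p.1 := by
    intro p hp p' hp' hne z hz hzp hzp'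
    have := hc.below_of_incomparable hG hz hzp hzp'
      (fun h => hne (eq_of_mem_exposed_of_below hp hp' h))
      (fun h => hne (eq_of_mem_exposed_of_below hp' hp h).symm)
    exact ⟨this.1, this.2.1, this.2.2.2.1⟩
  have hsource : ∀ p ∈ exposed Ψ, p.1 ≠ I.source := by
    rintro ⟨v, t⟩ hp rfl
    exact (hΨ.1 _ t (hsub hp)).2.2.1 (source_mem_burned Ψ t)
  have key : ∀ q, (∀ p ∈ exposed Ψ, ¬ Below I.graph I.source p.1 q) →
      (∀ p ∈ exposed Ψ, ∀ p' ∈ exposed Ψ, SameLeg I q p.1 p'.1 → p = p') →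
      ∃ q M, IsSelection I q M ∧ I.savedCount Ψ ≤ ∑ p ∈ M, I.gain p.1 := by
    intro q hq hleg
    refine ⟨q, exposed Ψ, ⟨fun v t h => (hΨ.1 v t (hsub h)).1, fun v t h => ?_,
      fun v t h => (hΨ.1 v t (hsub h)).2.2.2, fun v t h => hq _ h, fun t h₁ h₂ => ?_, hleg⟩,
      savedCount_le_sum_exposed hG Ψ⟩
    · -- Otherwise `v` would burn before it is protected.
      by_contra! hlt
      obtain ⟨hvt, ha, hfirst⟩ := mem_exposed.1 h
      refine (hΨ.1 v t hvt).2.2.1 (burned_mono (Nat.succ_le_of_lt hlt)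
        (mem_burned_of_not_protected hG _ v rfl ha ?_))
      rintro ⟨t', ht', hvt'⟩
      have := hfirst t' hvt'
      omega
    · exact (Finset.card_le_card (Finset.filter_subset_filter _ hsub)).trans (hΨ.2 t h₁ h₂)
  by_cases hm : ∃ m ∈ exposed Ψ, Below I.graph I.source m.1 c
  · -- Some protected vertex saves the center: one protection on each side of the source suffices.
    obtain ⟨m, hm, hmc⟩ := hm
    refine key I.source (fun p hp h => hsource p hp (h.antisymm hG (below_root _ _ _))) ?_
    rintro p hp p' hp' ⟨z, hz, hzp, hzp'⟩
    by_contra hne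
    obtain ⟨-, hcp, hcp'⟩ := hbranch p hp p' hp' hne z (ne_source_of_not_below hz) hzp hzp'
    obtain rfl := eq_of_mem_exposed_of_below hm hp (hmc.trans hG hcp)
    exact hcp' (hcp.antisymm hG hmc)
  · -- The center burns: one protection on each of the legs suffices.
    push Not at hm
    refine key c hm ?_
    rintro p hp p' hp' ⟨z, hz, hzp, hzp'⟩
    by_contra hne
    exact hz (hbranch p hp p' hp' hne z (ne_source_of_not_below hz) hzp hzp').1

include hG in
theorem SameLeg.trans {a b c : Fin I.n} (h : SameLeg I q a b) (h' : SameLeg I q b c) :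
    SameLeg I q a c := by
  obtain ⟨z, hz, hza, hzb⟩ := h
  obtain ⟨z', hz', hzb', hzc⟩ := h'
  rcases hzb.total hG hzb' with h | h
  · exact ⟨z, hz, hza, h.trans hG hzc⟩
  · exact ⟨z', hz', h.trans hG hza, hzc⟩

theorem SameLeg.symm {a b : Fin I.n} (h : SameLeg I q a b) : SameLeg I q b a := by
  obtain ⟨z, hz, hza, hzb⟩ := h
  exact ⟨z, hz, hzb, hza⟩

theorem SameLeg.refl {a : Fin I.n} (h : ¬ Below I.graph I.source a q) : SameLeg I q a a :=
  ⟨a, h, Below.refl _ _ _, Below.refl _ _ _⟩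

end Strategy

/-! ### An auction for weighted bipartite matchings -/

/-- A weighted matching problem.  The bidders are the classes of the relation `same`.  Slots are
pairs `(t, k)`; a bidder may use an item `v` of its class in a slot `(t, k)` if `ok v t k`, and
then has the gain `wt v`. -/
structure Market (n : ℕ) where
  ok : Fin n → ℕ → ℕ → Prop
  wt : Fin n → ℕ
  same : Fin n → Fin n → Prop
  lt_of_ok : ∀ {v t k}, ok v t k → t < n ∧ k < n
  wt_lt : ∀ {v t k}, ok v t k → wt v < n * n
  refl : ∀ {v t k}, ok v t k → same v v
  symm : ∀ {v w}, same v w → same w v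
  trans : ∀ {v w x}, same v w → same w x → same v x

namespace Market

variable {n : ℕ} (m : Market n) {p o : ℕ → ℕ → ℕ} {v : Fin n} {t k : ℕ}

/-- The bidder of `v` has no slot yet, and `(v, t, k)` is an item and a slot of maximal profit for
this bidder at the prices `p`, with positive profit.  The entry `o t k` is `0` if the slot `(t, k)`
is free, and `v + 1` if it is used for the item `v`. -/
structure CanBid (p o : ℕ → ℕ → ℕ) (v : Fin n) (t k : ℕ) : Prop where
  ok : m.ok v t k
  unassigned : ∀ t' < n, ∀ k' < n, ∀ v' : Fin n, o t' k' = v' + 1 → ¬ m.same v' v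
  pos : p t k < m.wt v
  max : ∀ v' t' k', m.ok v' t' k' → m.same v' v → m.wt v' + p t k ≤ m.wt v + p t' k'

/-- The invariant of the auction: free slots have price `0`, every bidder has at most one slot, and
the profit of every bidder with a slot is nonnegative, and maximal up to `1`. -/
structure Inv (p o : ℕ → ℕ → ℕ) : Prop where
  slot : ∀ t < n, ∀ k < n, o t k = 0 ∧ p t k = 0 ∨ ∃ v : Fin n, o t k = v + 1 ∧ m.ok v t k ∧
    p t k ≤ m.wt v ∧
      ∀ v' t' k', m.ok v' t' k' → m.same v' v → m.wt v' + p t k ≤ m.wt v + p t' k' + 1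
  inj : ∀ t < n, ∀ k < n, ∀ t' < n, ∀ k' < n, ∀ v v' : Fin n, o t k = v + 1 → o t' k' = v' + 1 →
    m.same v v' → t = t' ∧ k = k'

/-- Changing the entry `(t, k)` of a matrix to `c`. -/
def setEntry (p : ℕ → ℕ → ℕ) (t k c : ℕ) : ℕ → ℕ → ℕ :=
  fun t' k' => if t' = t ∧ k' = k then c else p t' k'

variable {m}

theorem Inv.bid (h : m.Inv p o) (hb : m.CanBid p o v t k) :
    m.Inv (setEntry p t k (p t k + 1)) (setEntry o t k (v + 1)) := by
  have hle : ∀ t' k', p t' k' ≤ setEntry p t k (p t k + 1) t' k' := by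
    intro t' k'
    unfold setEntry
    split_ifs with h'
    · rw [h'.1, h'.2]
      omega
    · exact le_rfl
  constructor
  · intro t' ht' k' hk'
    by_cases h' : t' = t ∧ k' = k
    · obtain ⟨rfl, rfl⟩ := h'
      refine Or.inr ⟨v, by simp [setEntry], hb.ok, ?_, fun v' t'' k'' h₁ h₂ => ?_⟩
      · have := hb.pos
        simpa [setEntry] using this
      · have h₃ := hb.max v' t'' k'' h₁ h₂
        have h₄ := hle t'' k''
        simp only [setEntry, and_self, if_true] at h₄ ⊢
        omega
    · have h₁ : setEntry o t k (v + 1) t' k' = o t' k' := if_neg h'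
      have h₂ : setEntry p t k (p t k + 1) t' k' = p t' k' := if_neg h'
      rw [h₁, h₂]
      rcases h.slot t' ht' k' hk' with h₃ | ⟨w, h₃, h₄, h₅, h₆⟩
      · exact Or.inl h₃
      · refine Or.inr ⟨w, h₃, h₄, h₅, fun v' t'' k'' h₇ h₈ => ?_⟩
        have := h₆ v' t'' k'' h₇ h₈
        have := hle t'' k''
        omega
  · intro t₁ ht₁ k₁ hk₁ t₂ ht₂ k₂ hk₂ v₁ v₂ h₁ h₂ hs
    unfold setEntry at h₁ h₂
    split_ifs at h₁ h₂ with h₃ h₄ h₄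
    · exact ⟨h₃.1.trans h₄.1.symm, h₃.2.trans h₄.2.symm⟩
    · obtain rfl : v = v₁ := Fin.ext (by omega)
      exact absurd (m.symm hs) (hb.unassigned t₂ ht₂ k₂ hk₂ v₂ h₂)
    · obtain rfl : v = v₂ := Fin.ext (by omega)
      exact absurd hs (hb.unassigned t₁ ht₁ k₁ hk₁ v₁ h₁)
    · exact h.inj t₁ ht₁ k₁ hk₁ t₂ ht₂ k₂ hk₂ v₁ v₂ h₁ h₂ hs

/-- The sum of the prices of all slots. -/
def total (n : ℕ) (p : ℕ → ℕ → ℕ) : ℕ := ∑ s ∈ Finset.range n ×ˢ Finset.range n, p s.1 s.2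

theorem total_lt_total_setEntry (ht : t < n) (hk : k < n) :
    total n p < total n (setEntry p t k (p t k + 1)) := by
  refine Finset.sum_lt_sum (fun s _ => ?_) ⟨(t, k), by simp [ht, hk], by simp [setEntry]⟩
  unfold setEntry
  split_ifs with h
  · rw [h.1, h.2]
    omega
  · exact le_rfl

/-- The bound `n ^ 4` is written as the number of iterations of four nested loops. -/
theorem Inv.total_lt (h : m.Inv p o) (hn : 0 < n) : total n p < n * (n * (n * (n * 1))) := by
  have hpos : 0 < n * n := Nat.mul_pos hn hn
  have hle : total n p ≤ (Finset.range n ×ˢ Finset.range n).card • (n * n - 1) := by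
    refine Finset.sum_le_card_nsmul _ _ _ fun s hs => ?_
    rw [Finset.mem_product, Finset.mem_range, Finset.mem_range] at hs
    rcases h.slot s.1 hs.1 s.2 hs.2 with ⟨-, h'⟩ | ⟨v, -, h', hp, -⟩
    · omega
    · have := m.wt_lt h'
      omega
  rw [Finset.card_product, Finset.card_range, smul_eq_mul] at hle
  refine hle.trans_lt ?_
  rw [show n * (n * (n * (n * 1))) = n * n * (n * n) by ring]
  exact Nat.mul_lt_mul_of_pos_left (by omega) hpos

open Classical in
/-- The triples `(v, t, k)` such that the slot `(t, k)` is used for the item `v`. -/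
noncomputable def assigned (n : ℕ) (o : ℕ → ℕ → ℕ) : Finset (Fin n × ℕ × ℕ) :=
  (Finset.univ ×ˢ Finset.range n ×ˢ Finset.range n).filter fun x => o x.2.1 x.2.2 = x.1 + 1

theorem mem_assigned {x : Fin n × ℕ × ℕ} :
    x ∈ assigned n o ↔ (x.2.1 < n ∧ x.2.2 < n) ∧ o x.2.1 x.2.2 = x.1 + 1 := by
  simp [assigned]

theorem Inv.of_mem_assigned (h : m.Inv p o) {x : Fin n × ℕ × ℕ} (hx : x ∈ assigned n o) :
    m.ok x.1 x.2.1 x.2.2 ∧ p x.2.1 x.2.2 ≤ m.wt x.1 ∧ ∀ v' t' k', m.ok v' t' k' →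
      m.same v' x.1 → m.wt v' + p x.2.1 x.2.2 ≤ m.wt x.1 + p t' k' + 1 := by
  rw [mem_assigned] at hx
  rcases h.slot _ hx.1.1 _ hx.1.2 with h' | ⟨v, h', h''⟩
  · omega
  · obtain rfl : v = x.1 := Fin.ext (by omega)
    exact h''

/-- At the end of the auction, a bidder without a slot has no positive profit. -/
theorem wt_le_price (hend : ∀ v t k, ¬ m.CanBid p o v t k) (hv : m.ok v t k)
    (h : ∀ y ∈ assigned n o, ¬ m.same y.1 v) : m.wt v ≤ p t k := by
  classical
  by_contra! hlt
  obtain ⟨x, hx, hmax⟩ := ((Finset.univ ×ˢ Finset.range n ×ˢ Finset.range n).filter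
    fun x : Fin n × ℕ × ℕ => m.ok x.1 x.2.1 x.2.2 ∧ m.same x.1 v).exists_max_image
    (fun x => (m.wt x.1 : ℤ) - p x.2.1 x.2.2)
    ⟨(v, t, k), by simp [hv, m.refl hv, (m.lt_of_ok hv).1, (m.lt_of_ok hv).2]⟩
  rw [Finset.mem_filter] at hx
  have hmax' : ∀ v' t' k', m.ok v' t' k' → m.same v' v →
      (m.wt v' : ℤ) - p t' k' ≤ m.wt x.1 - p x.2.1 x.2.2 := fun v' t' k' h₁ h₂ =>
    hmax (v', t', k') (by simp [h₁, h₂, (m.lt_of_ok h₁).1, (m.lt_of_ok h₁).2])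
  refine hend x.1 x.2.1 x.2.2 ⟨hx.2.1, fun t' ht' k' hk' v' ho hs => ?_, ?_, ?_⟩
  · exact h (v', t', k') (mem_assigned.2 ⟨⟨ht', hk'⟩, ho⟩) (m.trans hs hx.2.2)
  · have := hmax' v t k hv (m.refl hv)
    omega
  · intro v' t' k' h₁ h₂
    have := hmax' v' t' k' h₁ (m.trans h₂ hx.2.2)
    omega

/-- At the end of the auction, the prices and the profits of the bidders certify that the assignment
is optimal up to an error of `1` for each assigned slot. -/
theorem Inv.sum_wt_le (h : m.Inv p o) (hend : ∀ v t k, ¬ m.CanBid p o v t k)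
    (M : Finset (Fin n × ℕ × ℕ)) (hok : ∀ x ∈ M, m.ok x.1 x.2.1 x.2.2)
    (hslot : ∀ x ∈ M, ∀ y ∈ M, x.2 = y.2 → x = y)
    (hsame : ∀ x ∈ M, ∀ y ∈ M, m.same x.1 y.1 → x = y) :
    ∑ x ∈ M, m.wt x.1 ≤ ∑ x ∈ assigned n o, (m.wt x.1 + 1) := by
  classical
  -- `f x` is the entry of the assignment that belongs to the bidder of `x`.
  set N := M.filter fun x => ∃ y ∈ assigned n o, m.same y.1 x.1
  have hN : ∀ x : Fin n × ℕ × ℕ, ∃ y, x ∈ N → y ∈ assigned n o ∧ m.same y.1 x.1 := by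
    intro x
    by_cases hx : x ∈ N
    · obtain ⟨y, hy⟩ := (Finset.mem_filter.1 hx).2
      exact ⟨y, fun _ => hy⟩
    · exact ⟨x, fun h => absurd h hx⟩
  choose f hf using hN
  set profit : Fin n × ℕ × ℕ → ℕ := fun y => m.wt y.1 + 1 - p y.2.1 y.2.2
  have h₁ : ∀ x ∈ M, m.wt x.1 ≤ p x.2.1 x.2.2 + if x ∈ N then profit (f x) else 0 := by
    intro x hx
    split_ifs with hxN
    · obtain ⟨hy, hs⟩ := hf x hxN
      have := (h.of_mem_assigned hy).2.2 _ _ _ (hok x hx) (m.symm hs)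
      simp only [profit]
      omega
    · exact wt_le_price (p := p) hend (hok x hx) fun y hy hs =>
        hxN (Finset.mem_filter.2 ⟨hx, y, hy, hs⟩)
  have h₂ : ∑ x ∈ M, (if x ∈ N then profit (f x) else 0) ≤ ∑ y ∈ assigned n o, profit y := by
    rw [← Finset.sum_filter, Finset.filter_mem_eq_inter,
      Finset.inter_eq_right.2 (Finset.filter_subset _ _), ← Finset.sum_image (f := profit)]
    · refine Finset.sum_le_sum_of_subset fun y hy => ?_
      obtain ⟨x, hx, rfl⟩ := Finset.mem_image.1 hy
      exact (hf x hx).1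
    · intro x hx y hy hxy
      refine hsame x (Finset.mem_filter.1 hx).1 y (Finset.mem_filter.1 hy).1 ?_
      have h₃ := (hf x hx).2
      have h₄ := (hf y hy).2
      rw [← show f x = f y from hxy] at h₄
      exact m.trans (m.symm h₃) h₄
  have h₃ : ∑ x ∈ M, p x.2.1 x.2.2 ≤ ∑ y ∈ assigned n o, p y.2.1 y.2.2 := by
    rw [← Finset.sum_image (f := fun s : ℕ × ℕ => p s.1 s.2) (g := Prod.snd) (s := M)
        (fun x hx y hy => hslot x hx y hy),
      ← Finset.sum_image (f := fun s : ℕ × ℕ => p s.1 s.2) (g := Prod.snd) (s := assigned n o)]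
    · refine Finset.sum_le_sum_of_ne_zero fun s hs hp => ?_
      obtain ⟨x, hx, rfl⟩ := Finset.mem_image.1 hs
      obtain ⟨ht, hk⟩ := m.lt_of_ok (hok x hx)
      rcases h.slot _ ht _ hk with h' | ⟨v, h', -⟩
      · exact absurd h'.2 hp
      · exact Finset.mem_image.2 ⟨(v, x.2), mem_assigned.2 ⟨⟨ht, hk⟩, h'⟩, rfl⟩
    · intro x hx y hy hxy
      have hx := (mem_assigned.1 hx).2
      have hy := (mem_assigned.1 hy).2
      rw [← hxy] at hy
      exact Prod.ext (Fin.ext (by omega)) hxy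
  calc ∑ x ∈ M, m.wt x.1
      ≤ ∑ x ∈ M, (p x.2.1 x.2.2 + if x ∈ N then profit (f x) else 0) := Finset.sum_le_sum h₁
    _ ≤ ∑ y ∈ assigned n o, p y.2.1 y.2.2 + ∑ y ∈ assigned n o, profit y := by
      rw [Finset.sum_add_distrib]
      exact add_le_add h₃ h₂
    _ = ∑ x ∈ assigned n o, (m.wt x.1 + 1) := by
      rw [← Finset.sum_add_distrib]
      refine Finset.sum_congr rfl fun y hy => ?_
      have := (h.of_mem_assigned hy).2.1
      simp only [profit]
      omega

/-- No two slots are used for the same item. -/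
theorem Inv.fst_injOn (h : m.Inv p o) :
    Set.InjOn (Prod.fst : Fin n × ℕ × ℕ → Fin n) (assigned n o) := by
  intro x hx y hy hxy
  have hok := (h.of_mem_assigned hx).1
  have hx' := mem_assigned.1 hx
  have hy' := mem_assigned.1 hy
  have := h.inj _ hx'.1.1 _ hx'.1.2 _ hy'.1.1 _ hy'.1.2 x.1 y.1 hx'.2 hy'.2 (hxy ▸ m.refl hok)
  exact Prod.ext hxy (Prod.ext this.1 this.2)

theorem Inv.card_assigned_le (h : m.Inv p o) : (assigned n o).card ≤ n := by
  rw [← Finset.card_image_of_injOn h.fst_injOn]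
  simpa using Finset.card_le_univ ((assigned n o).image Prod.fst)

/-- If all weights are multiples of `n + 1`, the error is too small to matter. -/
theorem Inv.sum_le (h : m.Inv p o) (hend : ∀ v t k, ¬ m.CanBid p o v t k) {g : Fin n → ℕ}
    (hg : ∀ v, m.wt v = (n + 1) * g v) (M : Finset (Fin n × ℕ × ℕ))
    (hok : ∀ x ∈ M, m.ok x.1 x.2.1 x.2.2)
    (hslot : ∀ x ∈ M, ∀ y ∈ M, x.2 = y.2 → x = y)
    (hsame : ∀ x ∈ M, ∀ y ∈ M, m.same x.1 y.1 → x = y) :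
    ∑ x ∈ M, g x.1 ≤ ∑ x ∈ assigned n o, g x.1 := by
  have h₁ := h.sum_wt_le hend M hok hslot hsame
  have h₂ := h.card_assigned_le
  simp only [hg, Finset.sum_add_distrib, ← Finset.mul_sum, Finset.sum_const, smul_eq_mul,
    mul_one] at h₁
  by_contra! hlt
  nlinarith

end Market

/-! ### Selections as assignments -/

section Legs

variable {I : Instance} {q : Fin I.n} {p o : ℕ → ℕ → ℕ} (hG : I.graph.IsTree)

include hG in
theorem gain_lt {v : Fin I.n} (hv : v ≠ I.source) : I.gain v < I.n := by
  classical
  have hsub : (I.targets.filter fun u => Below I.graph I.source v u) ⊆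
      Finset.univ.erase I.source := by
    intro u hu
    rw [Finset.mem_filter] at hu
    refine Finset.mem_erase.2 ⟨?_, Finset.mem_univ _⟩
    rintro rfl
    exact hv (hu.2.antisymm hG (below_root _ _ _))
  have h := Finset.card_le_card hsub
  rw [Finset.card_erase_of_mem (Finset.mem_univ _), Finset.card_univ, Fintype.card_fin] at h
  have hn : 0 < I.n := Fin.pos I.source
  unfold Instance.gain
  omega

/-- The matching problem for the legs that remain when the path from the source to `q` is removed.
The slot `(t, k)` stands for the `k`-th of the protections at time step `t`.  Weights are scaled by
`I.n + 1`, so that the auction finds an exact optimum. -/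
noncomputable def legMarket (I : Instance) (hG : I.graph.IsTree) (q : Fin I.n) : Market I.n where
  ok v t k := (1 ≤ t ∧ t ≤ I.graph.dist I.source v ∧ (v, t) ∉ I.forbidden ∧
    ¬ Below I.graph I.source v q) ∧ k < I.n ∧ k < I.budget t
  wt v := (I.n + 1) * I.gain v
  same := SameLeg I q
  lt_of_ok h := ⟨h.1.2.1.trans_lt (dist_lt_card hG _ _), h.2.1⟩
  wt_lt h := by
    have := gain_lt hG (ne_source_of_not_below h.1.2.2.2)
    nlinarith
  refl h := SameLeg.refl h.1.2.2.2
  symm h := h.symm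
  trans h h' := h.trans hG h'

/-- The strategy that belongs to an assignment of slots. -/
noncomputable def assignedStrategy (I : Instance) (o : ℕ → ℕ → ℕ) : I.Strategy :=
  (Market.assigned I.n o).image fun x => (x.1, x.2.1)

theorem mem_assignedStrategy {v : Fin I.n} {t : ℕ} :
    (v, t) ∈ assignedStrategy I o ↔ t < I.n ∧ ∃ k < I.n, o t k = v + 1 := by
  simp only [assignedStrategy, Finset.mem_image, Market.mem_assigned, Prod.exists, Prod.mk.injEq]
  constructor
  · rintro ⟨v, t, k, ⟨⟨ht, hk⟩, h⟩, rfl, rfl⟩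
    exact ⟨ht, k, hk, h⟩
  · rintro ⟨ht, k, hk, h⟩
    exact ⟨v, t, k, ⟨⟨ht, hk⟩, h⟩, rfl, rfl⟩

variable {hG}

theorem isSelection_assignedStrategy (h : (legMarket I hG q).Inv p o) :
    IsSelection I q (assignedStrategy I o) := by
  have hok : ∀ v t, (v, t) ∈ assignedStrategy I o → ∃ k < I.n, o t k = v + 1 ∧ t < I.n ∧
      (legMarket I hG q).ok v t k := by
    intro v t hvt
    obtain ⟨ht, k, hk, ho⟩ := mem_assignedStrategy.1 hvt
    exact ⟨k, hk, ho, ht,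
      (h.of_mem_assigned (x := (v, t, k)) (Market.mem_assigned.2 ⟨⟨ht, hk⟩, ho⟩)).1⟩
  have hsame : ∀ (v : Fin I.n) t k (v' : Fin I.n) t' k', t < I.n → k < I.n → t' < I.n → k' < I.n → o t k = v + 1 →
      o t' k' = v' + 1 → SameLeg I q v v' → t = t' ∧ k = k' :=
    fun v t k v' t' k' ht hk ht' hk' => h.inj t ht k hk t' ht' k' hk' v v'
  refine ⟨fun v t hvt => ?_, fun v t hvt => ?_, fun v t hvt => ?_, fun v t hvt => ?_,
    fun t _ _ => ?_, ?_⟩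
  · obtain ⟨k, -, -, -, hk⟩ := hok v t hvt
    exact hk.1.1
  · obtain ⟨k, -, -, -, hk⟩ := hok v t hvt
    exact hk.1.2.1
  · obtain ⟨k, -, -, -, hk⟩ := hok v t hvt
    exact hk.1.2.2.1
  · obtain ⟨k, -, -, -, hk⟩ := hok v t hvt
    exact hk.1.2.2.2
  · -- The slots of the protections at time step `t` are distinct.
    choose! f hf using hok
    rw [← Finset.card_range (I.budget t)]
    refine Finset.card_le_card_of_injOn (fun x => f x.1 x.2) ?_ ?_
    · rintro ⟨v, t'⟩ hx
      obtain ⟨hv, rfl⟩ := Finset.mem_filter.1 (Finset.mem_coe.1 hx)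
      exact Finset.mem_coe.2 (Finset.mem_range.2 (hf v t' hv).2.2.2.2.2)
    · rintro ⟨v, t₁⟩ hx ⟨v', t₂⟩ hx' heq
      obtain ⟨hv, rfl⟩ := Finset.mem_filter.1 (Finset.mem_coe.1 hx)
      obtain ⟨hv', h'⟩ := Finset.mem_filter.1 (Finset.mem_coe.1 hx')
      simp only at h' heq
      subst h'
      have h₁ := (hf v _ hv).2.1
      have h₂ := (hf v' _ hv').2.1
      rw [heq] at h₁
      obtain rfl : v = v' := Fin.ext (by omega)
      rfl
  · rintro ⟨v, t⟩ hx ⟨v', t'⟩ hx' hs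
    obtain ⟨k, hk, ho, ht, hok₁⟩ := hok v t hx
    obtain ⟨k', hk', ho', ht', hok₂⟩ := hok v' t' hx'
    obtain ⟨rfl, rfl⟩ := hsame v t k v' t' k' ht hk ht' hk' ho ho' hs
    obtain rfl : v = v' := Fin.ext (by omega)
    rfl

theorem sum_assignedStrategy (h : (legMarket I hG q).Inv p o) :
    ∑ x ∈ assignedStrategy I o, I.gain x.1 = ∑ x ∈ Market.assigned I.n o, I.gain x.1 := by
  rw [assignedStrategy, Finset.sum_image]
  intro x hx y hy hxy
  exact h.fst_injOn hx hy (Prod.mk.inj hxy).1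

/-- At the end of the auction, the assignment is at least as good as every selection. -/
theorem sum_le_of_isSelection (h : (legMarket I hG q).Inv p o)
    (hend : ∀ v t k, ¬ (legMarket I hG q).CanBid p o v t k) {M : I.Strategy}
    (hM : IsSelection I q M) :
    ∑ x ∈ M, I.gain x.1 ≤ ∑ x ∈ Market.assigned I.n o, I.gain x.1 := by
  classical
  -- The slot of a protection is its rank among the protections at the same time.
  set rank : Fin I.n × ℕ → ℕ := fun x => (M.filter fun y => y.2 = x.2 ∧ y.1 < x.1).card
  have hrank : ∀ x ∈ M, ∀ y ∈ M, x.2 = y.2 → x.1 < y.1 → rank x < rank y := by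
    intro x hx y hy h₁ h₂
    refine Finset.card_lt_card ⟨fun z hz => ?_, fun hsub => ?_⟩
    · rw [Finset.mem_filter] at hz ⊢
      exact ⟨hz.1, hz.2.1.trans h₁, hz.2.2.trans h₂⟩
    · have := hsub (Finset.mem_filter.2 ⟨hx, h₁, h₂⟩)
      simp at this
  have hinj : ∀ x ∈ M, ∀ y ∈ M, x.2 = y.2 → rank x = rank y → x = y := by
    intro x hx y hy h₁ h₂
    rcases lt_trichotomy x.1 y.1 with h₃ | h₃ | h₃
    · have := hrank x hx y hy h₁ h₃
      omega
    · exact Prod.ext h₃ h₁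
    · have := hrank y hy x hx h₁.symm h₃
      omega
  set e : Fin I.n × ℕ → Fin I.n × ℕ × ℕ := fun x => (x.1, x.2, rank x)
  have he : Set.InjOn e M := by
    intro x _ y _ hxy
    exact Prod.ext (Prod.mk.inj hxy).1 (Prod.mk.inj (Prod.mk.inj hxy).2).1
  have hsum : ∑ x ∈ M, I.gain x.1 = ∑ x ∈ M.image e, I.gain x.1 := by
    rw [Finset.sum_image he]
  rw [hsum]
  refine h.sum_le hend (fun _ => rfl) _ ?_ ?_ ?_
  · intro y hy
    obtain ⟨⟨v, t⟩, hx, rfl⟩ := Finset.mem_image.1 hy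
    have h₁ := hM.one_le v t hx
    have h₂ := hM.le_dist v t hx
    refine ⟨⟨h₁, h₂, hM.not_forbidden v t hx, hM.not_below v t hx⟩, ?_, ?_⟩
    · have hlt : rank (v, t) < (Finset.univ : Finset (Fin I.n)).card := by
        refine lt_of_le_of_lt (Finset.card_le_card_of_injOn (t := Finset.univ.erase v) Prod.fst
          (fun y hy => ?_) fun y hy z hz hyz => ?_)
          (Finset.card_erase_lt_of_mem (Finset.mem_univ v))
        · have := (Finset.mem_filter.1 (Finset.mem_coe.1 hy)).2.2
          simp [this.ne]
        · have h₃ := (Finset.mem_filter.1 (Finset.mem_coe.1 hy)).2.1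
          have h₄ := (Finset.mem_filter.1 (Finset.mem_coe.1 hz)).2.1
          exact Prod.ext hyz (h₃.trans h₄.symm)
      simpa using hlt
    · refine lt_of_lt_of_le (Finset.card_lt_card ⟨fun y hy => ?_, fun hsub => ?_⟩)
        (hM.card_le t h₁ (h₂.trans (dist_lt_card hG _ _).le))
      · rw [Finset.mem_filter] at hy ⊢
        exact ⟨hy.1, hy.2.1⟩
      · have := hsub (Finset.mem_filter.2 ⟨hx, rfl⟩)
        simp at this
  · intro y hy z hz hyz
    obtain ⟨x, hx, rfl⟩ := Finset.mem_image.1 hy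
    obtain ⟨x', hx', rfl⟩ := Finset.mem_image.1 hz
    rw [hinj x hx x' hx' (congrArg Prod.fst hyz) (congrArg Prod.snd hyz)]
  · intro y hy z hz hyz
    obtain ⟨x, hx, rfl⟩ := Finset.mem_image.1 hy
    obtain ⟨x', hx', rfl⟩ := Finset.mem_image.1 hz
    rw [hM.eq_of_sameLeg x hx x' hx' hyz]

end Legs

/-! ### Terms for the logical notions -/

namespace Term

/-- A term, read as a condition, is true if its value is not `0`. -/
def Holds (A : Arrays) (ρ : ℕ → ℕ) (e : Term) : Prop := e.eval A ρ ≠ 0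

/-- Negation. -/
def notT (e : Term) : Term := sub (const 1) e

/-- Conjunction. -/
def andT (e f : Term) : Term := notT (add (notT e) (notT f))

/-- The relation `<`. -/
def ltT (e f : Term) : Term := sub f e

/-- The relation `≤`. -/
def leT (e f : Term) : Term := notT (sub e f)

/-- Equality. -/
def eqT (e f : Term) : Term := notT (add (sub e f) (sub f e))

/-- Existential quantification over `{0, …, n - 1}`. -/
def exT (x : ℕ) (e : Term) : Term := sum x e

/-- Universal quantification over `{0, …, n - 1}`. -/
def allT (x : ℕ) (e : Term) : Term := notT (sum x (notT e))

variable {A : Arrays} {ρ : ℕ → ℕ} {e f : Term} {x : ℕ}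

theorem holds_notT : Holds A ρ (notT e) ↔ ¬ Holds A ρ e := by
  simp only [Holds, notT, eval]
  omega

theorem holds_andT : Holds A ρ (andT e f) ↔ Holds A ρ e ∧ Holds A ρ f := by
  simp only [Holds, notT, andT, eval]
  omega

theorem holds_ltT : Holds A ρ (ltT e f) ↔ e.eval A ρ < f.eval A ρ := by
  simp only [Holds, ltT, eval]
  omega

theorem holds_leT : Holds A ρ (leT e f) ↔ e.eval A ρ ≤ f.eval A ρ := by
  simp only [Holds, leT, notT, eval]
  omega

theorem holds_eqT : Holds A ρ (eqT e f) ↔ e.eval A ρ = f.eval A ρ := by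
  simp only [Holds, eqT, notT, eval]
  omega

theorem holds_exT : Holds A ρ (exT x e) ↔ ∃ i < ρ 0, Holds A (Function.update ρ x i) e := by
  simp [Holds, exT, eval, Finset.sum_eq_zero_iff]

theorem holds_allT : Holds A ρ (allT x e) ↔ ∀ i < ρ 0, Holds A (Function.update ρ x i) e := by
  rw [allT, holds_notT, ← exT, holds_exT]
  simp only [holds_notT, not_exists, not_and, not_not]

theorem eval_ite (c : Term) [Decidable (Holds A ρ c)] :
    (ite c e f).eval A ρ = if Holds A ρ c then e.eval A ρ else f.eval A ρ := by
  simp only [eval, Holds]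
  congr

end Term

theorem Cmd.den_ite (c : Term) (p : Cmd) (ρ : ℕ → ℕ) (A : Arrays) [Decidable (c.Holds A ρ)] :
    (Cmd.ite c p).den ρ A = if c.Holds A ρ then p.den ρ A else A := by
  simp only [Cmd.den, Term.Holds]
  congr

/-! ### Rules for loops -/

section Iterate

variable {α : Type*} {f : ℕ → α → α} {n : ℕ} {A : α}

theorem iterate_invariant (P : ℕ → α → Prop) (h : ∀ i < n, ∀ A, P i A → P (i + 1) (f i A))
    (hA : P 0 A) : P n (iterate f n A) := by
  induction n with
  | zero => exact hA
  | succ n ih => exact h n (by omega) _ (ih fun i hi => h i (by omega))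

/-- If the iterations proceed along the preorder `R`, then properties that are monotone for `R` and
established by single iterations hold at the end. -/
theorem iterate_establish {P : α → Prop} {R : α → α → Prop} {Z : ℕ → α → Prop}
    (hrefl : ∀ A, R A A) (htrans : ∀ A B C, R A B → R B C → R A C)
    (hZ : ∀ i A B, R A B → Z i A → Z i B)
    (h : ∀ i < n, ∀ A, P A → P (f i A) ∧ R A (f i A) ∧ Z i (f i A)) (hA : P A) :
    P (iterate f n A) ∧ R A (iterate f n A) ∧ ∀ i < n, Z i (iterate f n A) := by
  induction n with
  | zero => exact ⟨hA, hrefl A, fun i hi => absurd hi (Nat.not_lt_zero i)⟩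
  | succ n ih =>
    obtain ⟨h₁, h₂, h₃⟩ := ih fun i hi => h i (by omega)
    obtain ⟨h₄, h₅, h₆⟩ := h n (by omega) _ h₁
    refine ⟨h₄, htrans _ _ _ h₂ h₅, fun i hi => ?_⟩
    rcases Nat.lt_succ_iff_lt_or_eq.1 hi with hi | rfl
    · exact hZ i _ _ h₅ (h₃ i hi)
    · exact h₆

/-- A step or pass: `f` preserves `P`, and either all is at rest, as expressed by `Z`, or the
potential `S` increases. -/
def Progress (P : α → Prop) (S : α → ℕ) (Z : α → Prop) (f : α → α) : Prop :=
  ∀ A, P A → P (f A) ∧ (Z A → f A = A) ∧ ((f A = A ∧ Z A) ∨ S A < S (f A))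

theorem Progress.iterate {P : α → Prop} {S : α → ℕ} {Z : ℕ → α → Prop}
    (h : ∀ i < n, Progress P S (Z i) (f i)) :
    Progress P S (fun A => ∀ i < n, Z i A) (iterate f n) := by
  induction n with
  | zero => exact fun A hA => ⟨hA, fun _ => rfl, Or.inl ⟨rfl, fun i hi => absurd hi (by omega)⟩⟩
  | succ n ih =>
    intro A hA
    obtain ⟨h₁, h₂, h₃⟩ := ih (fun i hi => h i (by omega)) A hA
    obtain ⟨h₄, h₅, h₆⟩ := h n (by omega) _ h₁
    refine ⟨h₄, fun hZ => ?_, ?_⟩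
    · have h₇ := h₂ fun i hi => hZ i (by omega)
      rw [h₇] at h₅
      exact (congrArg (f n) h₇).trans (h₅ (hZ n (by omega)))
    · rcases h₃ with ⟨h₃, h₃'⟩ | h₃
      · rw [h₃] at h₆
        rcases h₆ with ⟨h₆, h₆'⟩ | h₆
        · refine Or.inl ⟨(congrArg (f n) h₃).trans h₆, fun i hi => ?_⟩
          rcases Nat.lt_succ_iff_lt_or_eq.1 hi with hi | rfl
          · exact h₃' i hi
          · exact h₆'
        · exact Or.inr (h₆.trans_eq (congrArg S (congrArg (f n) h₃)).symm)
      · right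
        rcases h₆ with ⟨h₆, -⟩ | h₆
        · exact h₃.trans_eq (congrArg S h₆).symm
        · exact h₃.trans h₆

/-- `f` preserves `P`, and either reaches a state of rest or increases the potential `S` by
at least `N`. -/
def Converge (P : α → Prop) (S : α → ℕ) (Z : α → Prop) (N : ℕ) (f : α → α) : Prop :=
  ∀ A, P A → P (f A) ∧ (Z A → f A = A) ∧ (Z (f A) ∨ S A + N ≤ S (f A))

theorem Progress.converge {P : α → Prop} {S : α → ℕ} {Z : α → Prop} {f : α → α}
    (h : Progress P S Z f) : Converge P S Z 1 f := by
  intro A hA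
  obtain ⟨h₁, h₂, h₃⟩ := h A hA
  refine ⟨h₁, h₂, h₃.imp (fun h => ?_) id⟩
  rw [h.1]
  exact h.2

theorem Converge.iterate {P : α → Prop} {S : α → ℕ} {Z : α → Prop} {N : ℕ}
    (h : ∀ i < n, Converge P S Z N (f i)) : Converge P S Z (n * N) (iterate f n) := by
  induction n with
  | zero => exact fun A hA => ⟨hA, fun _ => rfl, Or.inr (by simp [Firefighter.iterate])⟩
  | succ n ih =>
    intro A hA
    obtain ⟨h₁, h₂, h₃⟩ := ih (fun i hi => h i (by omega)) A hA
    obtain ⟨h₄, h₅, h₆⟩ := h n (by omega) _ h₁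
    refine ⟨h₄, fun hZ => ?_, ?_⟩
    · have h₇ := h₂ hZ
      rw [h₇] at h₅
      exact (congrArg (f n) h₇).trans (h₅ hZ)
    · rcases h₃ with h₃ | h₃
      · left
        have : Firefighter.iterate f (n + 1) A = Firefighter.iterate f n A := h₅ h₃
        rwa [this]
      · refine h₆.imp id fun h₆ => ?_
        have : S (Firefighter.iterate f (n + 1) A) =
          S (f n (Firefighter.iterate f n A)) := rfl
        rw [Nat.succ_mul]
        omega

end Iterate

/-- Replacing the entries `(i, j)` with `i, j < n` of array `a` by the values of `e` at `x = i`
and `y = j`. -/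
def Cmd.fill (a x y : ℕ) (e : Term) : Cmd := .loop x (.loop y (.store a (.var x) (.var y) e))

/-- The effect of `Cmd.fill`, for a term `e` whose value does not depend on array `a`. -/
theorem Cmd.den_fill {a x y : ℕ} {e : Term} {ρ : ℕ → ℕ} {A : Arrays} (hxy : x ≠ y) (hx : x ≠ 0)
    (he : ∀ B : Arrays, (∀ b, b ≠ a → B b = A b) → ∀ i j,
      e.eval B (Function.update (Function.update ρ x i) y j) =
        e.eval A (Function.update (Function.update ρ x i) y j)) :
    (Cmd.fill a x y e).den ρ A = fun b i j => if b = a ∧ i < ρ 0 ∧ j < ρ 0 then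
      e.eval A (Function.update (Function.update ρ x i) y j) else A b i j := by
  have inner : ∀ m B i, (∀ b, b ≠ a → B b = A b) →
      Firefighter.iterate (fun j B => (Cmd.store a (.var x) (.var y) e).den
        (Function.update (Function.update ρ x i) y j) B) m B = fun b i' j =>
          if b = a ∧ i' = i ∧ j < m then
            e.eval A (Function.update (Function.update ρ x i) y j) else B b i' j := by
    intro m B i hB
    induction m with
    | zero => simp [Firefighter.iterate]
    | succ m ih =>
      rw [Firefighter.iterate, ih]
      simp only [Cmd.den, Term.eval, Function.update_self, Function.update_of_ne hxy]
      rw [he _ fun b hb => by funext i' j'; simp [hb, hB b hb]]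
      funext b i' j
      simp only [Arrays.set]
      by_cases hb : b = a <;> by_cases hi : i' = i <;> by_cases hj : j = m <;>
        simp [hb, hi, hj]
      simp [show j ≤ m ↔ j < m by omega]
  have outer : ∀ m, Firefighter.iterate (fun i B => (Cmd.loop y (.store a (.var x) (.var y) e)).den
        (Function.update ρ x i) B) m A = fun b i j => if b = a ∧ i < m ∧ j < ρ 0 then
      e.eval A (Function.update (Function.update ρ x i) y j) else A b i j := by
    intro m
    induction m with
    | zero => simp [Firefighter.iterate]
    | succ m ih =>
      rw [Firefighter.iterate, ih]
      simp only [Cmd.den, Function.update_of_ne hx.symm]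
      have := inner (ρ 0) (fun b i j => if b = a ∧ i < m ∧ j < ρ 0 then
        e.eval A (Function.update (Function.update ρ x i) y j) else A b i j) m
        fun b hb => by funext i' j'; simp [hb]
      simp only [Cmd.den] at this
      rw [this]
      funext b i j
      by_cases hb : b = a <;> by_cases hi : i = m <;> by_cases hj : j < ρ 0 <;>
        simp [hb, hi, hj]
      simp [show i ≤ m ↔ i < m by omega]
  exact outer (ρ 0)

/-! ### Distances -/

/-- Relaxation of the edge from `w` to `v`, for paths that start at `u`, where `u`, `v` and `w` are
the values of the variables `3`, `4` and `5`. -/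
def relaxCmd : Cmd :=
  .ite (.andT (.get 0 (.var 5) (.var 4))
      (.ltT (.add (.get 6 (.var 3) (.var 5)) (.const 1)) (.get 6 (.var 3) (.var 4))))
    (.store 6 (.var 3) (.var 4) (.add (.get 6 (.var 3) (.var 5)) (.const 1)))

/-- The all-pairs distances, computed in array `6` by repeated relaxation of all edges. -/
def distCmd : Cmd :=
  .seq (.fill 6 2 3 (.ite (.eqT (.var 2) (.var 3)) (.const 0) (.var 0)))
    (.loop 2 (.loop 3 (.loop 4 (.loop 5 relaxCmd))))

open Classical in
theorem den_relaxCmd {I : Instance} {B : Arrays} {ρ : ℕ → ℕ} {u v w : Fin I.n}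
    (hB : B 0 w v ≠ 0 ↔ I.graph.Adj w v) (hu : ρ 3 = u) (hv : ρ 4 = v) (hw : ρ 5 = w) :
    relaxCmd.den ρ B = if I.graph.Adj w v ∧ B 6 u w + 1 < B 6 u v then
      B.set 6 u v (B 6 u w + 1) else B := by
  have hc : Term.Holds B ρ (.andT (.get 0 (.var 5) (.var 4))
      (.ltT (.add (.get 6 (.var 3) (.var 5)) (.const 1)) (.get 6 (.var 3) (.var 4)))) ↔
      I.graph.Adj w v ∧ B 6 u w + 1 < B 6 u v := by
    rw [Term.holds_andT, Term.holds_ltT, ← hB]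
    simp only [Term.Holds, Term.eval, hu, hv, hw]
  rw [relaxCmd, Cmd.den_ite]
  simp only [hc, Cmd.den, Term.eval, hu, hv, hw]

theorem den_distCmd {I : Instance} (hG : I.graph.IsTree) {A : Arrays} {ρ : ℕ → ℕ}
    (hn : ρ 0 = I.n) (hA : ∀ u v : Fin I.n, A 0 u v ≠ 0 ↔ I.graph.Adj u v) :
    (∀ a, a ≠ 6 → distCmd.den ρ A a = A a) ∧
      ∀ u v : Fin I.n, distCmd.den ρ A 6 u v = I.graph.dist u v := by
  rw [distCmd, Cmd.den, Cmd.den_fill (by decide) (by decide)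
    (by intro B _ i j; simp [Term.eval, Term.eqT, Term.notT])]
  set B : Arrays := _
  change (∀ a, a ≠ 6 → Cmd.den _ ρ B a = A a) ∧ ∀ u v : Fin I.n, Cmd.den _ ρ B 6 u v = _
  have hB : ∀ a, a ≠ 6 → B a = A a := by
    intro a ha
    funext i j
    simp [B, ha]
  have hB6 : ∀ u v : Fin I.n, B 6 u v = if u = v then 0 else I.n := by
    intro u v
    simp only [B, true_and, hn, u.2, v.2, if_true]
    classical
    rw [Term.eval_ite]
    simp [Term.holds_eqT, Term.eval, hn, Fin.ext_iff]
  clear_value B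
  set P : Arrays → Prop := fun B =>
    (∀ a, a ≠ 6 → B a = A a) ∧ ∀ u v : Fin I.n, I.graph.dist u v ≤ B 6 u v
  set R : Arrays → Arrays → Prop := fun B B' => ∀ i j, B' 6 i j ≤ B 6 i j
  have hrefl : ∀ B, R B B := fun B i j => le_rfl
  have htrans : ∀ B B' B'', R B B' → R B' B'' → R B B'' :=
    fun B B' B'' h h' i j => (h' i j).trans (h i j)
  -- After `r` rounds the distances up to `r` are correct.
  set Q : ℕ → Arrays → Prop := fun r B =>
    P B ∧ ∀ u v : Fin I.n, I.graph.dist u v ≤ r → B 6 u v ≤ I.graph.dist u v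
  have round := iterate_invariant (n := ρ 0) (A := B) (f := fun i B =>
      Cmd.den (.loop 3 (.loop 4 (.loop 5 relaxCmd)))
        (Function.update ρ 2 i) B) Q
    (by
      intro r hr B hQ
      have h := iterate_establish (n := ρ 0) (A := B) (P := Q r) (R := R)
        (f := fun u B => Cmd.den (.loop 4 (.loop 5 relaxCmd))
          (Function.update (Function.update ρ 2 r) 3 u) B)
        (Z := fun u B => ∀ v < ρ 0, ∀ w < ρ 0, ∀ (hu : u < I.n) (hv : v < I.n) (hw : w < I.n),
          I.graph.Adj ⟨w, hw⟩ ⟨v, hv⟩ → I.graph.dist ⟨u, hu⟩ ⟨w, hw⟩ ≤ r →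
          B 6 u v ≤ I.graph.dist ⟨u, hu⟩ ⟨w, hw⟩ + 1) hrefl htrans
        (fun u B B' hR hZ v hv' w hw' hu hv hw h h' =>
          (hR u v).trans (hZ v hv' w hw' hu hv hw h h'))
        (by
          intro u hu B hQ
          refine iterate_establish (n := ρ 0) (A := B) (P := Q r) (R := R)
            (Z := fun v B => ∀ w < ρ 0, ∀ (hu : u < I.n) (hv : v < I.n) (hw : w < I.n),
              I.graph.Adj ⟨w, hw⟩ ⟨v, hv⟩ → I.graph.dist ⟨u, hu⟩ ⟨w, hw⟩ ≤ r →
              B 6 u v ≤ I.graph.dist ⟨u, hu⟩ ⟨w, hw⟩ + 1) hrefl htrans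
            (fun v B B' hR hZ w hw' hu hv hw h h' =>
              (hR u v).trans (hZ w hw' hu hv hw h h')) ?_ hQ
          intro v hv B hQ
          refine iterate_establish (n := ρ 0) (A := B) (P := Q r) (R := R)
            (Z := fun w B => ∀ (hu : u < I.n) (hv : v < I.n) (hw : w < I.n),
              I.graph.Adj ⟨w, hw⟩ ⟨v, hv⟩ → I.graph.dist ⟨u, hu⟩ ⟨w, hw⟩ ≤ r →
              B 6 u v ≤ I.graph.dist ⟨u, hu⟩ ⟨w, hw⟩ + 1) hrefl htrans
            (fun w B B' hR hZ hu hv hw h h' => (hR u v).trans (hZ hu hv hw h h')) ?_ hQ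
          intro w hw B hQ
          rw [hn] at hu hv hw
          obtain ⟨⟨hB₁, hB₂⟩, hB₃⟩ := hQ
          rw [den_relaxCmd (u := ⟨u, hu⟩) (v := ⟨v, hv⟩) (w := ⟨w, hw⟩)
            (by rw [hB₁ 0 (by decide)]; exact hA _ _) (by simp) (by simp) (by simp)]
          simp only
          split_ifs with hc
          · have hR : R B (B.set 6 u v (B 6 u w + 1)) := by
              intro i j
              simp only [Arrays.set]
              split_ifs with h
              · rw [h.2.1, h.2.2]
                omega
              · exact le_rfl
            refine ⟨⟨⟨fun a ha => ?_, fun u' v' => ?_⟩,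
              fun u' v' h => (hR _ _).trans (hB₃ u' v' h)⟩, hR, fun hu hv hw _ h => ?_⟩
            · rw [← hB₁ a ha]
              funext i j
              simp [Arrays.set, ha]
            · simp only [Arrays.set]
              split_ifs with h
              · obtain rfl : u' = ⟨u, hu⟩ := Fin.ext h.2.1
                obtain rfl : v' = ⟨v, hv⟩ := Fin.ext h.2.2
                have h₁ := hG.connected.dist_triangle (u := ⟨u, hu⟩) (v := ⟨w, hw⟩) (w := ⟨v, hv⟩)
                have h₂ := hB₂ ⟨u, hu⟩ ⟨w, hw⟩
                rw [SimpleGraph.dist_eq_one_iff_adj.2 hc.1] at h₁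
                exact h₁.trans (Nat.succ_le_succ h₂)
              · exact hB₂ u' v'
            · have := hB₃ ⟨u, hu⟩ ⟨w, hw⟩ h
              simp only [Arrays.set, and_self, if_true]
              exact Nat.succ_le_succ this
          · refine ⟨⟨⟨hB₁, hB₂⟩, hB₃⟩, hrefl B, fun hu hv hw h h' => ?_⟩
            have := hB₃ ⟨u, hu⟩ ⟨w, hw⟩ h'
            simp only at this
            have : ¬ B 6 u w + 1 < B 6 u v := fun h'' => hc ⟨h, h''⟩
            omega) hQ
      refine ⟨h.1.1, fun u v hd => ?_⟩
      by_cases huv : v = u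
      · subst huv
        exact h.1.2 v v (by simp)
      · obtain ⟨w, hwv, hd'⟩ := exists_parent hG huv
        rw [hd']
        exact h.2.2 u (by rw [hn]; exact u.2) v (by rw [hn]; exact v.2) w (by rw [hn]; exact w.2)
          u.2 v.2 w.2 hwv (show I.graph.dist u w ≤ r by omega))
    ⟨⟨hB, fun u v => by
      rw [hB6]
      split_ifs with h
      · simp [h]
      · exact (dist_lt_card hG u v).le⟩, fun u v h => by
      rw [Nat.le_zero, hG.connected.dist_eq_zero_iff] at h
      simp [hB6, h]⟩
  refine ⟨round.1.1, fun u v => le_antisymm (round.2 u v ?_) (round.1.2 u v)⟩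
  rw [hn]
  exact (dist_lt_card hG u v).le

/-! ### The notions of the algorithm as terms -/

/-- The entries of the arrays that the search for a strategy depends on. -/
structure Represents (I : Instance) (A : Arrays) : Prop where
  dist : ∀ u v : Fin I.n, A 6 u v = I.graph.dist u v
  targets : ∀ u : Fin I.n, A 1 0 u ≠ 0 ↔ u ∈ I.targets
  budget : ∀ t, 1 ≤ t → t ≤ I.n → A 2 0 t = I.budget t
  forbidden : ∀ (v : Fin I.n) t, 1 ≤ t → t ≤ I.n → (A 3 v t ≠ 0 ↔ (v, t) ∈ I.forbidden)

theorem Represents.congr {I : Instance} {A B : Arrays} (h : Represents I A)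
    (hB : ∀ a, a = 1 ∨ a = 2 ∨ a = 3 ∨ a = 6 → B a = A a) : Represents I B := by
  obtain ⟨h₁, h₂, h₃, h₄⟩ := h
  refine ⟨?_, ?_, ?_, ?_⟩
  · rwa [hB 6 (by simp)]
  · rwa [hB 1 (by simp)]
  · rwa [hB 2 (by simp)]
  · rwa [hB 3 (by simp)]

/-- The variables `0`, `1` and `2` hold `n`, the source and the vertex `q`. -/
structure Environment (I : Instance) (q : Fin I.n) (ρ : ℕ → ℕ) : Prop where
  n : ρ 0 = I.n
  source : ρ 1 = I.source
  q : ρ 2 = q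

theorem Environment.update {I : Instance} {q : Fin I.n} {ρ : ℕ → ℕ} (h : Environment I q ρ)
    (x : ℕ) (i : ℕ) (hx : 3 ≤ x := by decide) : Environment I q (Function.update ρ x i) := by
  refine ⟨?_, ?_, ?_⟩
  · rw [Function.update_of_ne (by omega), h.n]
  · rw [Function.update_of_ne (by omega), h.source]
  · rw [Function.update_of_ne (by omega), h.q]

namespace Term

/-- The term `e` has the value `c` in all environments that agree with `ρ` on the variables up
to `12`; variables from `13` on are bound in the terms below. -/
def Means (A : Arrays) (ρ : ℕ → ℕ) (e : Term) (c : ℕ) : Prop :=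
  ∀ τ : ℕ → ℕ, (∀ x < 13, τ x = ρ x) → e.eval A τ = c

/-- `a` is on the path from the source to `b`. -/
def belowT (a b : Term) : Term := eqT (add (get 6 (var 1) a) (get 6 a b)) (get 6 (var 1) b)

/-- `a` and `b` are in the same component after the removal of the path from the source to the
vertex in variable `2`. -/
def sameLegT (a b : Term) : Term :=
  exT 13 (andT (notT (belowT (var 13) (var 2))) (andT (belowT (var 13) a) (belowT (var 13) b)))

/-- The number of targets in the subtree of `a`. -/
def gainT (a : Term) : Term :=
  sum 14 (ite (andT (get 1 (const 0) (var 14)) (belowT a (var 14))) (const 1) (const 0))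

/-- The number of targets in the subtree of `a`, multiplied by `n + 1`. -/
def weightT (a : Term) : Term := add (sum 15 (gainT a)) (gainT a)

/-- The condition `(legMarket I hG q).ok v t k` for the variables `x`, `y`, `z` that hold
`v`, `t`, `k`. -/
def okT (x y z : ℕ) : Term :=
  andT (andT (var y) (andT (leT (var y) (get 6 (var 1) (var x)))
    (andT (notT (get 3 (var x) (var y))) (notT (belowT (var x) (var 2))))))
    (ltT (var z) (get 2 (const 0) (var y)))

/-- The condition that the item in variable `7` may be bid for the slot in variables `8`
and `9`. -/
def canBidT : Term :=
  andT (okT 7 8 9)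
    (andT (allT 11 (allT 12 (notT (andT (get 8 (var 11) (var 12))
        (sameLegT (sub (get 8 (var 11) (var 12)) (const 1)) (var 7))))))
      (andT (ltT (get 7 (var 8) (var 9)) (weightT (var 7)))
        (allT 10 (allT 11 (allT 12 (notT (andT (okT 10 11 12) (andT (sameLegT (var 10) (var 7))
          (ltT (add (weightT (var 7)) (get 7 (var 11) (var 12)))
            (add (weightT (var 10)) (get 7 (var 8) (var 9))))))))))))

/-- The total number of targets in the subtrees of the assigned vertices. -/
def valueT : Term :=
  sum 3 (sum 4 (sum 5 (ite (eqT (get 8 (var 4) (var 5)) (add (var 3) (const 1)))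
    (gainT (var 3)) (const 0))))

section

variable {I : Instance} {q : Fin I.n} {A : Arrays} {ρ : ℕ → ℕ}

theorem eval_var (A : Arrays) (ρ : ℕ → ℕ) (x : ℕ) : (var x).eval A ρ = ρ x := rfl

theorem eval_add (A : Arrays) (ρ : ℕ → ℕ) (e f : Term) :
    (add e f).eval A ρ = e.eval A ρ + f.eval A ρ := rfl

theorem means_var {x c : ℕ} (h : ρ x = c) (hx : x < 13 := by decide) : Means A ρ (var x) c :=
  fun _ hτ => (hτ x hx).trans h

theorem Means.eval_update {e : Term} {c : ℕ} (h : Means A ρ e c) {x : ℕ} (i : ℕ) (hx : 13 ≤ x) :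
    e.eval A (Function.update ρ x i) = c :=
  h _ fun y hy => Function.update_of_ne (by omega) _ _

theorem Means.update {e : Term} {c : ℕ} (h : Means A ρ e c) {x : ℕ} (i : ℕ) (hx : 13 ≤ x) :
    Means A (Function.update ρ x i) e c :=
  fun τ hτ => h τ fun y hy => (hτ y hy).trans (Function.update_of_ne (by omega) _ _)

theorem holds_belowT (hA : Represents I A) (hρ : Environment I q ρ) {e f : Term} {v w : Fin I.n}
    (he : e.eval A ρ = v) (hf : f.eval A ρ = w) :
    Holds A ρ (belowT e f) ↔ Below I.graph I.source v w := by
  simp only [belowT, holds_eqT, Term.eval, he, hf, hρ.source, hA.dist, Below]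

theorem holds_sameLegT (hA : Represents I A) (hρ : Environment I q ρ) {e f : Term}
    {v w : Fin I.n} (he : Means A ρ e v) (hf : Means A ρ f w) :
    Holds A ρ (sameLegT e f) ↔ SameLeg I q v w := by
  have h : ∀ z : Fin I.n, Holds A (Function.update ρ 13 z) (andT (notT (belowT (var 13) (var 2)))
      (andT (belowT (var 13) e) (belowT (var 13) f))) ↔ ¬ Below I.graph I.source z q ∧
        Below I.graph I.source z v ∧ Below I.graph I.source z w := by
    intro z
    have hρ' := hρ.update 13 z
    have hz : (var 13).eval A (Function.update ρ 13 z) = z := by simp [Term.eval]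
    rw [holds_andT, holds_andT, holds_notT, holds_belowT hA hρ' hz ((eval_var ..).trans hρ'.q),
      holds_belowT hA hρ' hz (he.eval_update _ le_rfl),
      holds_belowT hA hρ' hz (hf.eval_update _ le_rfl)]
  rw [sameLegT, holds_exT, hρ.n]
  constructor
  · rintro ⟨z, hz, hz'⟩
    exact ⟨⟨z, hz⟩, (h ⟨z, hz⟩).1 hz'⟩
  · rintro ⟨z, hz⟩
    exact ⟨z, z.2, (h z).2 hz⟩

theorem eval_gainT (hA : Represents I A) (hρ : Environment I q ρ) {e : Term} {v : Fin I.n}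
    (he : Means A ρ e v) : (gainT e).eval A ρ = I.gain v := by
  classical
  rw [gainT, Term.eval, hρ.n, Finset.sum_range, Instance.gain, Finset.card_filter,
    ← Finset.sum_filter_add_sum_filter_not Finset.univ (· ∈ I.targets),
    Finset.sum_eq_zero (s := Finset.univ.filter fun x => ¬ x ∈ I.targets)]
  · rw [Finset.filter_mem_eq_inter, Finset.univ_inter, add_zero]
    refine Finset.sum_congr rfl fun u hu => ?_
    rw [eval_ite, holds_andT, holds_belowT (w := u) hA (hρ.update 14 u)
      (he.eval_update _ (by decide)) (by simp [Term.eval])]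
    have : Holds A (Function.update ρ 14 u) (get 1 (const 0) (var 14)) := by
      simpa [Holds, Term.eval, hA.targets] using hu
    simp [this, Term.eval]
  · intro u hu
    rw [eval_ite, holds_andT]
    have : ¬ Holds A (Function.update ρ 14 u) (get 1 (const 0) (var 14)) := by
      simpa [Holds, Term.eval, ← hA.targets] using hu
    simp [this, Term.eval]

theorem eval_weightT (hA : Represents I A) (hρ : Environment I q ρ) {e : Term} {v : Fin I.n}
    (he : Means A ρ e v) : (weightT e).eval A ρ = (I.n + 1) * I.gain v := by
  have : ∀ i, (gainT e).eval A (Function.update ρ 15 i) = I.gain v := fun i =>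
    eval_gainT hA (hρ.update 15 i) (he.update i (by decide))
  rw [weightT, Term.eval, Term.eval, eval_gainT hA hρ he, hρ.n]
  simp only [this, Finset.sum_const, Finset.card_range, smul_eq_mul]
  ring

variable {hG : I.graph.IsTree}

theorem holds_okT (hA : Represents I A) (hρ : Environment I q ρ) {x y z t k : ℕ} {v : Fin I.n}
    (hx : ρ x = v) (hy : ρ y = t) (hz : ρ z = k) (ht : t < I.n) (hk : k < I.n) :
    Holds A ρ (okT x y z) ↔ (legMarket I hG q).ok v t k := by
  rw [okT, holds_andT, holds_andT, holds_andT, holds_andT, holds_notT, holds_notT, holds_leT,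
    holds_ltT, holds_belowT hA hρ (v := v) (w := q)
      ((eval_var ..).trans hx) ((eval_var ..).trans hρ.q)]
  simp only [Holds, Term.eval, hx, hy, hz, hρ.source, hA.dist, legMarket]
  by_cases h : 1 ≤ t
  · rw [hA.budget t h ht.le, hA.forbidden v t h ht.le]
    simp [hk, h, Nat.one_le_iff_ne_zero.1 h]
  · simp [show t = 0 by omega]

theorem holds_canBidT (hA : Represents I A) (hρ : Environment I q ρ) {t k : ℕ} {v : Fin I.n}
    (h7 : ρ 7 = v) (h8 : ρ 8 = t) (h9 : ρ 9 = k) (ht : t < I.n) (hk : k < I.n)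
    (hinv : (legMarket I hG q).Inv (A 7) (A 8)) :
    Holds A ρ canBidT ↔ (legMarket I hG q).CanBid (A 7) (A 8) v t k := by
  have hW : (weightT (var 7)).eval A ρ = (legMarket I hG q).wt v :=
    eval_weightT hA hρ (means_var h7)
  have h₁ : Holds A ρ (allT 11 (allT 12 (notT (andT (get 8 (var 11) (var 12))
      (sameLegT (sub (get 8 (var 11) (var 12)) (const 1)) (var 7)))))) ↔
      ∀ t' < I.n, ∀ k' < I.n, ∀ v' : Fin I.n, A 8 t' k' = v' + 1 →
        ¬ (legMarket I hG q).same v' v := by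
    simp only [holds_allT, Function.update_of_ne (show 0 ≠ 11 by decide), hρ.n]
    refine forall₂_congr fun t' ht' => forall₂_congr fun k' hk' => ?_
    have hρ' := (hρ.update 11 t').update 12 k'
    rw [holds_notT, holds_andT]
    have hget : ∀ τ : ℕ → ℕ,
        (∀ x < 13, τ x = Function.update (Function.update ρ 11 t') 12 k' x) →
        (get 8 (var 11) (var 12)).eval A τ = A 8 t' k' := by
      intro τ hτ
      simp [Term.eval, hτ 11 (by decide), hτ 12 (by decide)]
    have hget' : Holds A (Function.update (Function.update ρ 11 t') 12 k')
        (get 8 (var 11) (var 12)) ↔ A 8 t' k' ≠ 0 := by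
      rw [Holds, hget _ fun _ _ => rfl]
    rw [hget']
    rcases hinv.slot t' ht' k' hk' with h | ⟨w, h, -⟩
    · simp [h.1]
    · rw [holds_sameLegT hA hρ' (v := w) (w := v) (fun τ hτ => ?_) (means_var (by simp [h7])), h]
      · constructor
        · intro h' v' hv'
          obtain rfl : w = v' := Fin.ext (by omega)
          exact fun h'' => h' ⟨by omega, h''⟩
        · exact fun h' h'' => h' w rfl h''.2
      · rw [Term.eval, hget τ hτ, h]
        rfl
  have h₂ : Holds A ρ (allT 10 (allT 11 (allT 12 (notT (andT (okT 10 11 12)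
      (andT (sameLegT (var 10) (var 7)) (ltT (add (weightT (var 7)) (get 7 (var 11) (var 12)))
        (add (weightT (var 10)) (get 7 (var 8) (var 9)))))))))) ↔
      ∀ v' t' k', (legMarket I hG q).ok v' t' k' → (legMarket I hG q).same v' v →
        (legMarket I hG q).wt v' + A 7 t k ≤ (legMarket I hG q).wt v + A 7 t' k' := by
    simp only [holds_allT, Function.update_of_ne (show 0 ≠ 11 by decide),
      Function.update_of_ne (show 0 ≠ 10 by decide), hρ.n]
    have key : ∀ (v' : Fin I.n) (t' k' : ℕ), t' < I.n → k' < I.n →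
        (Holds A (Function.update (Function.update (Function.update ρ 10 v') 11 t') 12 k')
          (notT (andT (okT 10 11 12) (andT (sameLegT (var 10) (var 7))
            (ltT (add (weightT (var 7)) (get 7 (var 11) (var 12)))
              (add (weightT (var 10)) (get 7 (var 8) (var 9))))))) ↔
        ((legMarket I hG q).ok v' t' k' → (legMarket I hG q).same v' v →
        (legMarket I hG q).wt v' + A 7 t k ≤ (legMarket I hG q).wt v + A 7 t' k')) := by
      intro v' t' k' ht' hk'
      have hρ' := ((hρ.update 10 v').update 11 t').update 12 k'
      have h10 : Means A (Function.update (Function.update (Function.update ρ 10 v') 11 t') 12 k')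
        (var 10) v' := means_var (by simp)
      have h7' : Means A (Function.update (Function.update (Function.update ρ 10 v') 11 t') 12 k')
        (var 7) v := means_var (by simp [h7])
      rw [holds_notT, holds_andT, holds_andT, holds_ltT,
        holds_okT (hG := hG) hA hρ' (v := v') (t := t') (k := k') (by simp) (by simp) (by simp)
          ht' hk',
        holds_sameLegT hA hρ' h10 h7', eval_add, eval_add, eval_weightT hA hρ' h10,
        eval_weightT hA hρ' h7']
      simp only [Term.eval]
      have e8 : Function.update (Function.update (Function.update ρ 10 ↑v') 11 t') 12 k' 8 = t := by
        simp [h8]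
      have e9 : Function.update (Function.update (Function.update ρ 10 ↑v') 11 t') 12 k' 9 = k := by
        simp [h9]
      have e11 : Function.update (Function.update (Function.update ρ 10 ↑v') 11 t') 12 k' 11 =
        t' := by simp
      have e12 : Function.update (Function.update (Function.update ρ 10 ↑v') 11 t') 12 k' 12 =
        k' := by simp
      rw [e8, e9, e11, e12, not_and, not_and, not_lt]
      rfl
    constructor
    · intro h v' t' k' hok
      obtain ⟨ht', hk'⟩ := (legMarket I hG q).lt_of_ok hok
      exact (key v' t' k' ht' hk').1 (h v' v'.2 t' ht' k' hk') hok
    · intro h v' hv' t' ht' k' hk'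
      exact (key ⟨v', hv'⟩ t' k' ht' hk').2 (h _ t' k')
  rw [canBidT, holds_andT, holds_andT, holds_andT, holds_ltT, h₁, h₂, hW,
    holds_okT (hG := hG) hA hρ h7 h8 h9 ht hk]
  simp only [Term.eval, h8, h9]
  exact ⟨fun h => ⟨h.1, h.2.1, h.2.2.1, h.2.2.2⟩, fun h => ⟨h.ok, h.unassigned, h.pos, h.max⟩⟩

theorem eval_valueT (hA : Represents I A) (hρ : Environment I q ρ) :
    valueT.eval A ρ = ∑ x ∈ Market.assigned I.n (A 8), I.gain x.1 := by
  classical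
  rw [Market.assigned, Finset.sum_filter, Finset.sum_product]
  simp only [Finset.sum_product]
  rw [valueT, Term.eval, hρ.n, Finset.sum_range]
  refine Finset.sum_congr rfl fun v _ => ?_
  rw [Term.eval, Function.update_of_ne (by decide), hρ.n]
  refine Finset.sum_congr rfl fun t _ => ?_
  rw [Term.eval, Function.update_of_ne (by decide), Function.update_of_ne (by decide), hρ.n]
  refine Finset.sum_congr rfl fun k _ => ?_
  have hρ' := ((hρ.update 3 v).update 4 t).update 5 k
  rw [eval_ite, eval_gainT hA hρ' (v := v) (means_var (by simp)), holds_eqT]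
  simp [Term.eval]

end

end Term

/-! ### The auction as a command -/

/-- One bid, if it is possible. -/
def bidCmd : Cmd :=
  .ite .canBidT (.seq (.store 8 (.var 8) (.var 9) (.add (.var 7) (.const 1)))
    (.store 7 (.var 8) (.var 9) (.add (.get 7 (.var 8) (.var 9)) (.const 1))))

/-- All possible bids, one after the other. -/
def passCmd : Cmd := .loop 7 (.loop 8 (.loop 9 bidCmd))

/-- The auction: the prices are in array `7` and the assignment is in array `8`. -/
def auctionCmd : Cmd :=
  .seq (.fill 7 3 4 (.const 0)) (.seq (.fill 8 3 4 (.const 0))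
    (.loop 3 (.loop 4 (.loop 5 (.loop 6 passCmd)))))

section

variable {I : Instance} {q : Fin I.n} {A : Arrays} {ρ : ℕ → ℕ} {hG : I.graph.IsTree}

theorem den_bidCmd_of_canBid {B : Arrays} (hc : Term.Holds B ρ .canBidT) {t k : ℕ} {v : Fin I.n}
    (h7 : ρ 7 = v) (h8 : ρ 8 = t) (h9 : ρ 9 = k) :
    (∀ a, a ≠ 7 → a ≠ 8 → bidCmd.den ρ B a = B a) ∧
      bidCmd.den ρ B 7 = Market.setEntry (B 7) t k (B 7 t k + 1) ∧
      bidCmd.den ρ B 8 = Market.setEntry (B 8) t k (v + 1) := by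
  classical
  rw [bidCmd, Cmd.den_ite, if_pos hc]
  simp only [Cmd.den, Term.eval, h7, h8, h9]
  refine ⟨fun a ha ha' => ?_, ?_, ?_⟩ <;> funext i j
  · simp [Arrays.set, ha, ha']
  · simp [Arrays.set, Market.setEntry]
  · simp [Arrays.set, Market.setEntry]

theorem den_bidCmd_of_not_canBid {B : Arrays} (hc : ¬ Term.Holds B ρ .canBidT) :
    bidCmd.den ρ B = B := by
  classical
  rw [bidCmd, Cmd.den_ite, if_neg hc]

/-- The arrays other than the prices and the assignment are those of `A`, and the invariant of the
auction holds. -/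
def AuctionState (hG : I.graph.IsTree) (q : Fin I.n) (A B : Arrays) : Prop :=
  (∀ a, a ≠ 7 → a ≠ 8 → B a = A a) ∧ (legMarket I hG q).Inv (B 7) (B 8)

/-- No item `i` can be bid for the slot `(j, k)`. -/
def NoBid (hG : I.graph.IsTree) (q : Fin I.n) (B : Arrays) (i j k : ℕ) : Prop :=
  ∀ hi : i < I.n, ¬ (legMarket I hG q).CanBid (B 7) (B 8) ⟨i, hi⟩ j k

theorem progress_bidCmd (hA : Represents I A) (hρ : Environment I q ρ) {i j k : ℕ}
    (hi : i < I.n) (hj : j < I.n) (hk : k < I.n) (h7 : ρ 7 = i) (h8 : ρ 8 = j) (h9 : ρ 9 = k) :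
    Progress (AuctionState hG q A) (fun B => Market.total I.n (B 7))
      (fun B => NoBid hG q B i j k) (bidCmd.den ρ) := by
  rintro B ⟨hB, hinv⟩
  have hBA : Represents I B := hA.congr fun a ha => hB a (by omega) (by omega)
  have hiff := Term.holds_canBidT (v := ⟨i, hi⟩) hBA hρ h7 h8 h9 hj hk hinv
  by_cases hc : Term.Holds B ρ .canBidT
  · obtain ⟨h₁, h₂, h₃⟩ := den_bidCmd_of_canBid (v := ⟨i, hi⟩) hc h7 h8 h9
    refine ⟨⟨fun a ha ha' => (h₁ a ha ha').trans (hB a ha ha'), ?_⟩,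
      fun h => absurd (hiff.1 hc) (h hi), Or.inr ?_⟩
    · rw [h₂, h₃]
      exact hinv.bid (hiff.1 hc)
    · simp only [h₂]
      exact Market.total_lt_total_setEntry hj hk
  · rw [den_bidCmd_of_not_canBid hc]
    exact ⟨⟨hB, hinv⟩, fun _ => rfl, Or.inl ⟨rfl, fun _ h => hc (hiff.2 h)⟩⟩

theorem progress_passCmd (hA : Represents I A) (hρ : Environment I q ρ) :
    Progress (AuctionState hG q A) (fun B => Market.total I.n (B 7))
      (fun B => ∀ i < I.n, ∀ j < I.n, ∀ k < I.n, NoBid hG q B i j k) (passCmd.den ρ) := by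
  have h : Progress (AuctionState hG q A) (fun B => Market.total I.n (B 7))
      (fun B => ∀ i < ρ 0, ∀ j < ρ 0, ∀ k < ρ 0, NoBid hG q B i j k) (passCmd.den ρ) := by
    refine Progress.iterate fun i hi => ?_
    refine Progress.iterate (n := ρ 0) fun j hj => ?_
    refine Progress.iterate (n := ρ 0) fun k hk => ?_
    rw [hρ.n] at hi hj hk
    exact progress_bidCmd hA (((hρ.update 7 i).update 8 j).update 9 k) hi hj hk (by simp) (by simp)
      (by simp)
  rwa [hρ.n] at h

theorem den_auctionCmd (hA : Represents I A) (hρ : Environment I q ρ) :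
    (∀ a, a ≠ 7 → a ≠ 8 → auctionCmd.den ρ A a = A a) ∧
      (legMarket I hG q).Inv (auctionCmd.den ρ A 7) (auctionCmd.den ρ A 8) ∧
      ∀ v t k, ¬ (legMarket I hG q).CanBid (auctionCmd.den ρ A 7) (auctionCmd.den ρ A 8) v t k := by
  rw [auctionCmd, Cmd.den, Cmd.den_fill (by decide) (by decide) fun _ _ _ _ => rfl, Cmd.den,
    Cmd.den_fill (by decide) (by decide) fun _ _ _ _ => rfl]
  set B : Arrays := _
  change (∀ a, a ≠ 7 → a ≠ 8 → Cmd.den _ ρ B a = A a) ∧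
    (legMarket I hG q).Inv (Cmd.den _ ρ B 7) (Cmd.den _ ρ B 8) ∧
    ∀ v t k, ¬ (legMarket I hG q).CanBid (Cmd.den _ ρ B 7) (Cmd.den _ ρ B 8) v t k
  have hB : AuctionState hG q A B := by
    refine ⟨fun a h7 h8 => ?_, ?_⟩
    · funext i j
      simp [B, h7, h8]
    · have hzero : ∀ a, a = 7 ∨ a = 8 → ∀ t < I.n, ∀ k < I.n, B a t k = 0 := by
        rintro a (rfl | rfl) t ht k hk <;> simp [B, hρ.n, ht, hk, Term.eval]
      refine ⟨fun t ht k hk => Or.inl ⟨hzero 8 (by simp) t ht k hk, hzero 7 (by simp) t ht k hk⟩,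
        fun t ht k hk _ _ _ _ _ _ h => ?_⟩
      rw [hzero 8 (by simp) t ht k hk] at h
      omega
  clear_value B
  -- There are more passes than the sum of the prices can ever be, so that the auction comes to rest.
  have h : Converge (AuctionState hG q A) (fun B => Market.total I.n (B 7))
      (fun B => ∀ i < I.n, ∀ j < I.n, ∀ k < I.n, NoBid hG q B i j k)
      (ρ 0 * (ρ 0 * (ρ 0 * (ρ 0 * 1))))
      (Cmd.den (.loop 3 (.loop 4 (.loop 5 (.loop 6 passCmd)))) ρ) := by
    refine Converge.iterate fun i₁ _ => ?_
    refine Converge.iterate (n := ρ 0) fun i₂ _ => ?_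
    refine Converge.iterate (n := ρ 0) fun i₃ _ => ?_
    refine Converge.iterate (n := ρ 0) fun i₄ _ => ?_
    exact (progress_passCmd hA ((((hρ.update 3 i₁).update 4 i₂).update 5 i₃).update 6 i₄)).converge
  rw [hρ.n] at h
  obtain ⟨⟨h₁, h₂⟩, -, h₃⟩ := h B hB
  refine ⟨h₁, h₂, fun v t k hc => ?_⟩
  rcases h₃ with h₃ | h₃
  · obtain ⟨ht, hk⟩ := (legMarket I hG q).lt_of_ok hc.ok
    exact h₃ v v.2 t ht k hk v.2 hc
  · exact absurd ((Nat.le_add_left _ _).trans h₃) (not_le.2 (h₂.total_lt (Fin.pos q)))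

end

/-! ### The algorithm -/

/-- The best selection for the vertex `q` in variable `2` replaces the strategy in array `4` unless
its value is less than the best value so far, which is the entry `(0, 0)` of array `9`. -/
def improveCmd : Cmd :=
  .seq auctionCmd (.ite (.leT (.get 9 (.const 0) (.const 0)) .valueT)
    (.seq (.store 9 (.const 0) (.const 0) .valueT)
      (.fill 4 3 4 (.exT 5 (.eqT (.get 8 (.var 4) (.var 5)) (.add (.var 3) (.const 1)))))))

/-- The algorithm: distances, and then the best selection over all vertices `q`. -/
def mainCmd : Cmd := .seq distCmd (.loop 2 improveCmd)

theorem mainCmd_wf : mainCmd.wf [0, 1] = true := by decide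

section

variable {I : Instance} {q : Fin I.n} {A : Arrays} {ρ : ℕ → ℕ}

/-- The strategy that is described by array `4`. -/
noncomputable def decodeArrays (I : Instance) (A : Arrays) : I.Strategy :=
  I.decode ⟨fun _ => 0, A⟩

theorem mem_decodeArrays {v : Fin I.n} {t : ℕ} :
    (v, t) ∈ decodeArrays I A ↔ (1 ≤ t ∧ t ≤ I.n) ∧ A 4 v t ≠ 0 := by
  simp [decodeArrays, Instance.decode]

/-- The invariant of the loop over `q`, after the first `i` iterations: array `4` describes a valid
strategy that saves at least the value in array `9`, and this value is at least that of every
selection for the vertices before `i`.  The column `n` of array `4`, which is decoded as the last time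
step, is never written, because every distance is less than `n`. -/
structure BestSoFar (I : Instance) (i : ℕ) (A : Arrays) : Prop where
  represents : Represents I A
  last_column : ∀ v : Fin I.n, A 4 v I.n = 0
  isValid : I.IsValid (decodeArrays I A)
  le_savedCount : A 9 0 0 ≤ I.savedCount (decodeArrays I A)
  sum_le : ∀ q : Fin I.n, (q : ℕ) < i → ∀ M, IsSelection I q M → ∑ x ∈ M, I.gain x.1 ≤ A 9 0 0

theorem BestSoFar.improve (hG : I.graph.IsTree) (h : BestSoFar I q A) (hρ : Environment I q ρ) :
    BestSoFar I (q + 1) (improveCmd.den ρ A) := by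
  classical
  obtain ⟨hB, hinv, hend⟩ := den_auctionCmd (hG := hG) h.represents hρ
  rw [improveCmd, Cmd.den, Cmd.den_ite]
  set B : Arrays := auctionCmd.den ρ A
  have hBrep : Represents I B := h.represents.congr fun a ha => hB a (by omega) (by omega)
  have hB4 : B 4 = A 4 := hB 4 (by decide) (by decide)
  have hB9 : B 9 = A 9 := hB 9 (by decide) (by decide)
  have hval := Term.eval_valueT hBrep hρ
  have hopt := fun M (hM : IsSelection I q M) => sum_le_of_isSelection hinv hend hM
  have hdec : decodeArrays I B = decodeArrays I A := by
    ext ⟨v, t⟩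
    rw [mem_decodeArrays, mem_decodeArrays, hB4]
  rw [Term.holds_leT, hval]
  simp only [Term.eval, hB9]
  split_ifs with hle
  · rw [Cmd.den, Cmd.den, hval]
    simp only [Term.eval]
    set C : Arrays := B.set 9 0 0 (∑ x ∈ Market.assigned I.n (B 8), I.gain x.1)
    have hC : ∀ a, a ≠ 9 → C a = B a := by
      intro a ha
      funext i j
      simp [C, Arrays.set, ha]
    rw [Cmd.den_fill (by decide) (by decide) (by
      intro D hD i j
      simp [Term.eval, Term.exT, Term.eqT, Term.notT, hD 8 (by decide)])]
    set D : Arrays := _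
    change BestSoFar I (q + 1) D
    have hD : ∀ a, a ≠ 4 → D a = C a := by
      intro a ha
      funext i j
      simp [D, ha]
    have hD9 : D 9 0 0 = ∑ x ∈ Market.assigned I.n (B 8), I.gain x.1 := by
      rw [hD 9 (by decide)]
      simp [C, Arrays.set]
    have hD4 : ∀ v : Fin I.n, ∀ t, D 4 v t ≠ 0 ↔ if t < I.n then ∃ k < I.n, B 8 t k = v + 1
        else A 4 v t ≠ 0 := by
      intro v t
      simp only [D, true_and, hρ.n, v.2]
      split_ifs with ht
      · rw [← Term.Holds, Term.holds_exT]
        simp [Term.holds_eqT, Term.eval, hρ.n, hC 8 (by decide)]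
      · rw [hC 4 (by decide), hB4]
    have hdec : decodeArrays I D = assignedStrategy I (B 8) := by
      ext ⟨v, t⟩
      rw [mem_decodeArrays, hD4, mem_assignedStrategy]
      constructor
      · rintro ⟨⟨-, ht⟩, h'⟩
        rcases ht.lt_or_eq with ht | rfl
        · rw [if_pos ht] at h'
          exact ⟨ht, h'⟩
        · rw [if_neg (lt_irrefl _)] at h'
          exact absurd (h.last_column v) h'
      · intro h'
        have := (isSelection_assignedStrategy hinv).one_le v t (mem_assignedStrategy.2 h')
        rw [if_pos h'.1]
        exact ⟨⟨this, h'.1.le⟩, h'.2⟩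
    have hsel := isSelection_assignedStrategy hinv
    refine ⟨hBrep.congr fun a ha => (hD a (by omega)).trans (hC a (by omega)), fun v => ?_, ?_, ?_,
      fun q' hq' M hM => ?_⟩
    · by_contra h'
      have := (hD4 v I.n).1 h'
      rw [if_neg (lt_irrefl _)] at this
      exact this (h.last_column v)
    · rw [hdec]
      exact hsel.isValid hG
    · rw [hdec, hD9, ← sum_assignedStrategy hinv]
      exact hsel.sum_gain_le hG
    · rw [hD9]
      rcases Nat.lt_succ_iff_lt_or_eq.1 hq' with hq' | hq'
      · exact (h.sum_le q' hq' M hM).trans hle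
      · obtain rfl : q' = q := Fin.ext hq'
        exact hopt M hM
  · refine ⟨hBrep, fun v => ?_, ?_, ?_, fun q' hq' M hM => ?_⟩
    · rw [hB4]
      exact h.last_column v
    · rw [hdec]
      exact h.isValid
    · rw [hdec, hB9]
      exact h.le_savedCount
    · rw [hB9]
      rcases Nat.lt_succ_iff_lt_or_eq.1 hq' with hq' | hq'
      · exact h.sum_le q' hq' M hM
      · obtain rfl : q' = q := Fin.ext hq'
        exact (hopt M hM).trans (not_le.1 hle).le

theorem encode_adj (I : Instance) (u v : Fin I.n) :
    I.encode.arr 0 u v ≠ 0 ↔ I.graph.Adj u v := by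
  simp [Instance.encode]

theorem isOptimal_mainCmd (hG : I.graph.IsTree) {c : Fin I.n} (hc : OnlyBranchesAt I.graph c) :
    I.IsOptimal (decodeArrays I (mainCmd.den I.encode.reg I.encode.arr)) := by
  have hn : I.encode.reg 0 = I.n := by simp [Instance.encode]
  have hs : I.encode.reg 1 = I.source := by simp [Instance.encode]
  obtain ⟨hB, hdist⟩ := den_distCmd hG hn (encode_adj I)
  rw [mainCmd, Cmd.den]
  set B : Arrays := distCmd.den I.encode.reg I.encode.arr
  have hempty : decodeArrays I B = ∅ := by
    ext ⟨v, t⟩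
    rw [mem_decodeArrays, hB 4 (by decide)]
    simp [Instance.encode]
  have hinit : BestSoFar I 0 B := by
    refine ⟨⟨hdist, fun u => ?_, fun t h₁ h₂ => ?_, fun v t h₁ h₂ => ?_⟩, fun v => ?_, ?_, ?_,
      fun q hq => absurd hq (Nat.not_lt_zero _)⟩
    · rw [hB 1 (by decide)]
      simp [Instance.encode]
    · rw [hB 2 (by decide)]
      simp [Instance.encode, h₁, h₂]
    · rw [hB 3 (by decide)]
      simp [Instance.encode, h₁, h₂]
    · rw [hB 4 (by decide)]
      simp [Instance.encode]
    · rw [hempty]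
      exact ⟨fun v t h => absurd h (Finset.notMem_empty _), fun t _ _ => by simp⟩
    · rw [hB 9 (by decide)]
      simp [Instance.encode]
  have hfinal : BestSoFar I (I.encode.reg 0) (Cmd.den (.loop 2 improveCmd) I.encode.reg B) := by
    refine iterate_invariant (BestSoFar I) (fun i hi A hA => ?_) hinit
    rw [hn] at hi
    exact BestSoFar.improve (q := ⟨i, hi⟩) hG hA ⟨by simp [hn], by simp [hs], by simp⟩
  refine ⟨hfinal.isValid, fun Ψ hΨ => ?_⟩
  obtain ⟨q, M, hM, hle⟩ := exists_isSelection hG hc hΨ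
  refine (hle.trans (hfinal.sum_le q ?_ M hM)).trans hfinal.le_savedCount
  rw [hn]
  exact q.2

end

theorem polyTimeSolvable_isKStar :
    PolyTimeSolvable {I | ∃ k : ℕ, 1 ≤ k ∧ IsKStar k I.graph} := by
  obtain ⟨f, hf⟩ := mainCmd.runs_compile [0, 1] (by simp) mainCmd_wf
  refine ⟨mainCmd.compile, f, ?_⟩
  rintro I ⟨k, -, hk⟩
  obtain ⟨hG, c, hc⟩ := hk.isTree_and_onlyBranchesAt
  obtain ⟨σ, t, hr, ht, -, hσ⟩ := hf I.encode
  refine ⟨σ, t, hr, ?_, ?_⟩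
  · simpa [Instance.encode] using ht
  · have hdec : I.decode σ = decodeArrays I (mainCmd.den I.encode.reg I.encode.arr) := by
      simp only [decodeArrays, Instance.decode, hσ 4 (by decide)]
    rw [hdec]
    exact isOptimal_mainCmd hG hc

theorem PolyTimeSolvable.mono {C D : Set Instance} (h : PolyTimeSolvable D) (hCD : C ⊆ D) :
    PolyTimeSolvable C := by
  obtain ⟨p, f, hp⟩ := h
  exact ⟨p, f, fun I hI => hp I (hCD hI)⟩

end Firefighter

theorem mainTheorem5 :
    (∀ k : ℕ, 1 ≤ k → ∀ b : ℕ, 1 ≤ b →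
      Firefighter.PolyTimeSolvable
        {I | Firefighter.IsKStar k I.graph ∧ I ∈ Firefighter.MaxSave b}) ∧
    Firefighter.PolyTimeSolvable
      {I | ∃ k : ℕ, 1 ≤ k ∧ Firefighter.IsKStar k I.graph} :=
  ⟨fun k hk _ _ => Firefighter.polyTimeSolvable_isKStar.mono fun _ hI => ⟨k, hk, hI.1⟩,
    Firefighter.polyTimeSolvable_isKStar⟩
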